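/- **Setting.** Let $\mathbf k$ be a differential field of characteristic $0$ with one derivation $\delta$, and let $\mathbf k\{Y\}=\mathbf k[y^{(j)} : y\in Y,\ j\ge 0]$ be the ring of ordinary differential polynomials in the finite set of indeterminates $Y=\{y_1,\dots,y_n\}$, with $\delta y^{(j)}=y^{(j+1)}$. Fix a ranking, i.e. a total order on the derivatives $y^{(j)}$ such that $\delta^l u\ge u$ and $u\ge v\Rightarrow\delta^l u\ge\delta^l v$ for all $l\ge 0$. For $f\notin\mathbf k$, the leader $\operatorname{ld}f=y_i^{(e)}$ is the highest derivative in $f$, $\operatorname{lv}f=y_i$ is its leading indeterminate, and $\operatorname{rk}f=(\operatorname{ld}f)^q$ with $q=\deg_{\operatorname{ld}f}f$ is its rank; ranks are compared by leader, then by degree. (Elements of $\mathbf k$ have no rank; their rank counts as different from that of any $f\notin\mathbf k$.) The initial $\mathbf i_f$ is the coefficient of $(\operatorname{ld}f)^q$ in $f$, and the separant is $\mathbf s_f=\partial f/\partial \operatorname{ld}f$. A polynomial $f$ is algebraically reduced w.r.t. $g$ if $\deg_{\operatorname{ld}g}f<\deg_{\operatorname{ld}g}g$, and reduced w.r.t.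 $g$ if moreover no proper derivative of $\operatorname{ld}g$ occurs in $f$. For a set $F$, $[F]$ is the differential ideal generated by $F$, $H_F$ is the set of initials and separants of the elements of $F$, $S^\infty$ is the multiplicative set containing $1$ generated by $S$, $A:S^\infty=\{a\mid \exists s\in S^\infty,\ sa\in A\}$, and $m_i(F)$ is the maximal order of $y_i$ in $F$ ($0$ if $y_i$ does not occur). A set of elements of $\mathbf k\{Y\}\setminus\mathbf k$ is weak d-triangular if the leading indeterminates of its elements are pairwise distinct, and triangular if their leaders are. For a triangular set $\mathbb B$, let $\mathbb B^0$ (resp. $\mathbb B^*$) consist of the elements of lowest (resp. highest) rank among the elements of $\mathbb B$ with the same leading indeterminate. The algebraic remainder $\mathsf{algrem}(f,S)$ is obtained from $f$ by successive pseudo-divisions by elements $p\in S$ (as univariate polynomials in $\operatorname{ld}p$) w.r.t. which the current polynomial is not algebraically reduced, in any order, until it is algebraically reduced w.r.t. all elements of $S$. Here a pseudo-division of $f$ by $p$ replaces $f$ by some $g$ with $\mathbf i_p^e f=qp+g$ for some $e\ge 0$ and $q\in\mathbf k\{Y\}$, and $\deg_{\operatorname{ld}p}g<\deg_{\operatorname{ld}p}p$.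 **Algorithm Differentiate&Autoreduce.** Input: a weak d-triangular set $\mathbb C=\{C_1,\dots,C_k\}$ with $\operatorname{ld}C_i=y_i^{(d_i)}$ (after renumbering the indeterminates), and non-negative integers $m_1,\dots,m_k$ with $m_i\ge m_i(\mathbb C)$. For a set $F$ let $F_{\{m_i\}}$ be the set of $f\in F$ such that, if $\operatorname{ld}f=y_i^{(e)}$ with $1\le i\le k$, then $e\le m_i$. Start with $\mathbb D:=\mathbb C$, $\mathbb B:=\varnothing$. While $\mathbb D\cup(\delta\mathbb B^*)_{\{m_i\}}\ne\varnothing$: let $f$ be its element of least rank; if $f\in\mathbb D$, put $\bar f:=\mathsf{algrem}(f,\mathbb B)$ and remove $f$ from $\mathbb D$; otherwise put $\bar f:=\mathsf{algrem}(f,\mathbb B\cup(\delta\mathbb B^0\setminus\{f\}))$; if $\operatorname{rk}\bar f\ne\operatorname{rk}f$, return $\{1\}$; otherwise replace $\mathbb B$ by $\mathbb B\cup\{\bar f\}$. At the end of the loop return $\mathbb B$. **Proposition.** Algorithm Differentiate&Autoreduce terminates and is correct. That is, whatever the order of the pseudo-divisions, every computation of an algebraic remainder terminates, the loop runs at most $\sum_{i=1}^k(m_i-d_i+1)$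 times, every computation ends with an output, and every output is either a triangular set $$\mathbb B=\{B_i^j\mid 1\le i\le k,\ 0\le j\le m_i-d_i\}$$ such that - $\operatorname{rk}B_i^j=\operatorname{rk}\delta^jC_i$, and $B_i^j$ is reduced w.r.t. every element of $\mathbb C\setminus\{C_i\}$; - $m_i(\mathbb B)\le m_i$ for $1\le i\le k$, and $m_i(\mathbb B)\le m_i(\mathbb C)+\sum_{j=1}^k(m_j-d_j)$ for $k<i\le n$; - $\mathbb B\subset[\mathbb B^0]\subset[\mathbb C]\subset[\mathbb B]:H_{\mathbb B}^\infty$; - $H_{\mathbb B}\subset H_{\mathbb C}^\infty+[\mathbb C]$ and $H_{\mathbb C}\subset(H_{\mathbb B}^\infty+[\mathbb B]):H_{\mathbb B}^\infty$; or $\{1\}$, and then $[\mathbb C]:H_{\mathbb C}^\infty=(1)$. -/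

import Mathlib

open scoped Pointwise Differential

namespace DiffAlg

/-- The derivative `y^(j)` of a differential indeterminate `y ∈ Y` (ordinary case). -/
@[ext]
structure Deriv (Y : Type*) where
  var : Y
  ord : ℕ

/-- The action of `δ^k` on derivatives. -/
def Deriv.shift {Y : Type*} (k : ℕ) (u : Deriv Y) : Deriv Y := ⟨u.var, u.ord + k⟩

/-- A total order on the derivatives is a ranking. -/
structure IsRanking (Y : Type*) [LinearOrder (Deriv Y)] : Prop where
  le_shift : ∀ (k : ℕ) (u : Deriv Y), u ≤ u.shift k
  shift_le_shift : ∀ (k : ℕ) (u v : Deriv Y), v ≤ u → v.shift k ≤ u.shift k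

noncomputable section

open MvPolynomial

/-- The ring `K{Y}` of ordinary differential polynomials. -/
abbrev DiffPoly (Y K : Type*) [Field K] := MvPolynomial (Deriv Y) K

section derivation

variable {Y K : Type*} [Field K] [Differential K]

/-- Apply the derivation of `K` to all coefficients. -/
def coeffDeriv (p : DiffPoly Y K) : DiffPoly Y K :=
  ∑ s ∈ p.support, monomial s (p.coeff s)′

theorem coeff_coeffDeriv (p : DiffPoly Y K) (t : Deriv Y →₀ ℕ) :
    (coeffDeriv p).coeff t = (p.coeff t)′ := by
  classical
  rw [coeffDeriv, coeff_sum]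
  simp only [coeff_monomial]
  rw [Finset.sum_ite_eq']
  split_ifs with h
  · rfl
  · rw [notMem_support_iff.mp h, map_zero]

theorem coeffDeriv_add (p q : DiffPoly Y K) :
    coeffDeriv (p + q) = coeffDeriv p + coeffDeriv q := by
  ext t
  simp [coeff_coeffDeriv]

theorem coeffDeriv_mul (p q : DiffPoly Y K) :
    coeffDeriv (p * q) = p * coeffDeriv q + q * coeffDeriv p := by
  classical
  ext t
  rw [coeff_coeffDeriv, mul_comm q, coeff_add, coeff_mul, coeff_mul, coeff_mul, map_sum,
    ← Finset.sum_add_distrib]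
  refine Finset.sum_congr rfl fun x _ => ?_
  rw [Derivation.leibniz, coeff_coeffDeriv, coeff_coeffDeriv, smul_eq_mul, smul_eq_mul]
  ring

/-- The derivation `δ` of `K{Y}`: it extends the derivation of `K` and sends `y^(j)` to
`y^(j+1)`. -/
def δ : Derivation ℤ (DiffPoly Y K) (DiffPoly Y K) :=
  Derivation.mk'
    ((AddMonoidHom.mk' (fun p : DiffPoly Y K =>
        coeffDeriv p + mkDerivation K (fun u : Deriv Y => (X (u.shift 1) : DiffPoly Y K)) p)
      (fun p q => by rw [coeffDeriv_add, map_add]; ring)).toIntLinearMap)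
    (fun p q => by
      simp only [AddMonoidHom.coe_toIntLinearMap, AddMonoidHom.mk'_apply, coeffDeriv_mul,
        Derivation.leibniz, smul_eq_mul]
      ring)

/-- The differential ideal `[F]` generated by `F`. -/
def diffIdeal (F : Set (DiffPoly Y K)) : Ideal (DiffPoly Y K) :=
  sInf {I | F ⊆ I ∧ ∀ f ∈ I, δ f ∈ I}

end derivation

section ranks

variable {Y K : Type*} [Field K] [LinearOrder (Deriv Y)]

/-- The leader of `f`; it is `⊥` exactly for `f ∈ K`. -/
def ld (f : DiffPoly Y K) : WithBot (Deriv Y) := f.vars.max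

/-- The leading indeterminate of `f`. -/
def lv (f : DiffPoly Y K) : WithBot Y := (ld f).map Deriv.var

/-- The rank `u^d` of `f`, encoded as the pair `(u, d)`. Pairs are ordered lexicographically, and
elements of `K` have rank `⊥`. -/
def rk (f : DiffPoly Y K) : WithBot (Deriv Y ×ₗ ℕ) :=
  (ld f).map fun u => toLex (u, f.degreeOf u)

/-- The coefficient of `u^d` in `f`, for `f` regarded as a univariate polynomial in `u`. -/
def coeffIn (u : Deriv Y) (d : ℕ) (f : DiffPoly Y K) : DiffPoly Y K :=
  ∑ s ∈ f.support with s u = d, monomial (s.erase u) (f.coeff s)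

/-- The initial of `f ∉ K`. -/
def initial (f : DiffPoly Y K) : DiffPoly Y K :=
  WithBot.recBotCoe f (fun u => coeffIn u (f.degreeOf u) f) (ld f)

/-- The separant of `f ∉ K`. -/
def separant (f : DiffPoly Y K) : DiffPoly Y K :=
  WithBot.recBotCoe 0 (fun u => pderiv u f) (ld f)

/-- The set `H_F` of initials and separants of elements of `F`. -/
def initSep (F : Set (DiffPoly Y K)) : Set (DiffPoly Y K) := initial '' F ∪ separant '' F

/-- `S^∞`: the multiplicative set containing `1` and generated by `S`. -/
def powers (S : Set (DiffPoly Y K)) : Set (DiffPoly Y K) := Submonoid.closure S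

/-- `A : S^∞ = {a | ∃ s ∈ S^∞, s a ∈ A}`. -/
def saturation (A S : Set (DiffPoly Y K)) : Set (DiffPoly Y K) :=
  {a | ∃ s ∈ powers S, s * a ∈ A}

/-- `f` is partially reduced w.r.t. `g`. -/
def PartiallyReduced (f g : DiffPoly Y K) : Prop :=
  ∀ u : Deriv Y, ld g = u → ∀ k : ℕ, 1 ≤ k → u.shift k ∉ f.vars

/-- `f` is algebraically reduced w.r.t. `g`. -/
def AlgReduced (f g : DiffPoly Y K) : Prop :=
  ∀ u : Deriv Y, ld g = u → f.degreeOf u < g.degreeOf u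

/-- `f` is reduced w.r.t. `g`. -/
def Reduced (f g : DiffPoly Y K) : Prop := PartiallyReduced f g ∧ AlgReduced f g

/-- Weak d-triangular sets, in the ordinary case: no element is in `K` and the leading
indeterminates are pairwise distinct. -/
def WeakDTriangular (F : Set (DiffPoly Y K)) : Prop :=
  (∀ f ∈ F, ld f ≠ ⊥) ∧ Set.InjOn lv F

/-- Triangular sets: no element is in `K` and the leaders are pairwise distinct. -/
def Triangular (F : Set (DiffPoly Y K)) : Prop :=
  (∀ f ∈ F, ld f ≠ ⊥) ∧ Set.InjOn ld F

/-- The maximal order of the indeterminate `y` in the (finite) set `F`; it is `0` if `y` does not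
occur in `F`. -/
def maxOrd (y : Y) (F : Set (DiffPoly Y K)) : ℕ :=
  sSup {j | ∃ f ∈ F, (⟨y, j⟩ : Deriv Y) ∈ f.vars}

/-- `B⁰`: the elements of least rank among those with the same leading indeterminate. -/
def lowest (B : Set (DiffPoly Y K)) : Set (DiffPoly Y K) :=
  {f ∈ B | ∀ g ∈ B, lv g = lv f → rk f ≤ rk g}

/-- `B^*`: the elements of greatest rank among those with the same leading indeterminate. -/
def highest (B : Set (DiffPoly Y K)) : Set (DiffPoly Y K) :=
  {f ∈ B | ∀ g ∈ B, lv g = lv f → rk g ≤ rk f}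

/-! ### Algebraic pseudo-remainders -/

/-- `g` is a pseudo-remainder of `f` by some `p ∈ S` with respect to which `f` is not algebraically
reduced, for `f` and `p` regarded as univariate polynomials in the leader of `p`. -/
def PseudoDivision (S : Set (DiffPoly Y K)) (f g : DiffPoly Y K) : Prop :=
  ∃ p ∈ S, ∃ u : Deriv Y, ld p = u ∧ p.degreeOf u ≤ f.degreeOf u ∧ g.degreeOf u < p.degreeOf u ∧
    ∃ (e : ℕ) (q : DiffPoly Y K), initial p ^ e * f = q * p + g

/-- `g` is a value of `algrem(f, S)`: it results from `f` by successive pseudo-divisions by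
elements of `S`, in any order, and is algebraically reduced w.r.t. all elements of `S`. -/
def AlgRem (S : Set (DiffPoly Y K)) (f g : DiffPoly Y K) : Prop :=
  Relation.ReflTransGen (PseudoDivision S) f g ∧ ∀ p ∈ S, AlgReduced g p

/-- The computation of `algrem(f, S)` terminates: there is no infinite sequence of successive
pseudo-divisions that starts at `f`. -/
def AlgRemTerminates (S : Set (DiffPoly Y K)) (f : DiffPoly Y K) : Prop :=
  ∀ g : ℕ → DiffPoly Y K, g 0 = f → ∃ j, ¬ PseudoDivision S (g j) (g (j + 1))

end ranks

/-! ### The algorithm Differentiate&Autoreduce -/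

section algorithm

variable {Y K : Type*} [Field K] [Differential K] [LinearOrder (Deriv Y)]

/-- `F_{m_i}`: the elements of `F` with leader `y_i^(e)`, `e ≤ m_i`, if their leading indeterminate
is one of the `y_i`. -/
def bounded {k : ℕ} (y : Fin k → Y) (m : Fin k → ℕ) (F : Set (DiffPoly Y K)) :
    Set (DiffPoly Y K) :=
  {f ∈ F | ∀ (i : Fin k) (e : ℕ), ld f = (⟨y i, e⟩ : Deriv Y) → e ≤ m i}

/-- The set `D ∪ (δ B^*)_{m_i}`. -/
def candidates {k : ℕ} (y : Fin k → Y) (m : Fin k → ℕ) (D B : Set (DiffPoly Y K)) :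
    Set (DiffPoly Y K) :=
  D ∪ bounded y m (δ '' highest B)

/-- `f` is an element of least rank of `F`. -/
def IsMinRank (F : Set (DiffPoly Y K)) (f : DiffPoly Y K) : Prop :=
  f ∈ F ∧ ∀ g ∈ F, rk f ≤ rk g

open Classical in
/-- The set w.r.t. which the chosen `f` is reduced: `B` if `f ∈ D`, and `B ∪ (δ B⁰ ∖ {f})`
otherwise. -/
def reducers (D B : Set (DiffPoly Y K)) (f : DiffPoly Y K) : Set (DiffPoly Y K) :=
  if f ∈ D then B else B ∪ ((δ '' lowest B) \ {f})

/-- States of a computation: in the loop, with the current values of `D` and `B`, or halted inside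
the loop, with an output. -/
inductive State (Y K : Type*) [Field K] where
  | loop (D B : Set (DiffPoly Y K)) : State Y K
  | halted (out : Set (DiffPoly Y K)) : State Y K

/-- One iteration of the loop. For `f ∉ D` the set `D ∖ {f}` is `D`. -/
inductive Iteration {k : ℕ} (y : Fin k → Y) (m : Fin k → ℕ) : State Y K → State Y K → Prop
  | update (D B : Set (DiffPoly Y K)) (f g : DiffPoly Y K)
      (hmin : IsMinRank (candidates y m D B) f) (hrem : AlgRem (reducers D B f) f g)
      (hrk : rk g = rk f) : Iteration y m (.loop D B) (.loop (D \ {f}) (B ∪ {g}))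
  | abort (D B : Set (DiffPoly Y K)) (f g : DiffPoly Y K)
      (hmin : IsMinRank (candidates y m D B) f) (hrem : AlgRem (reducers D B f) f g)
      (hrk : rk g ≠ rk f) : Iteration y m (.loop D B) (.halted {1})

/-- In the given state the algorithm stops with output `out`. -/
inductive Returns {k : ℕ} (y : Fin k → Y) (m : Fin k → ℕ) : State Y K → Set (DiffPoly Y K) → Prop
  | exit (D B : Set (DiffPoly Y K)) (h : candidates y m D B = ∅) : Returns y m (.loop D B) B
  | halted (out : Set (DiffPoly Y K)) : Returns y m (.halted out) out

/-- The state is reached by a computation with input `C`. -/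
def Reachable {k : ℕ} (y : Fin k → Y) (m : Fin k → ℕ) (C : Set (DiffPoly Y K)) (s : State Y K) :
    Prop :=
  Relation.ReflTransGen (Iteration y m) (.loop C ∅) s

end algorithm

end

end DiffAlg

/-! The computed elements form a table: row `i` holds `n i` entries with the ranks of `C i`, `δ (C
i)`, and so on, and an iteration tries to append one entry. Correctness is a loop invariant
(`Invariant`, preserved by `Invariant.update`). Every iteration that does not abort raises `∑ n i`
by one, and `n i ≤ m i - d i + 1`; this bounds the number of iterations, and when no candidate is
left all rows are full.

The algebra lies in a single reduction of `f` with leader `u` to `g`. No reducer has leader `u`, so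
the divisors actually used have smaller leaders, and they and their initials are free of `u`. Hence
the congruence `a f ≡ g` modulo the reducers may be read coefficientwise in `u` and differentiated
with respect to `u` (`exists_mul_sub_mem_of_pseudoDivisions`). If the rank is kept, the initial and
separant of `g` are congruent to `a` times those of `f`, which carries the statements on `H_B` and
`H_C` along. If the rank drops, `a` times the initial of `f` lies in `[C]`; being also congruent to
an element of `H_C^∞`, it makes the saturation trivial (`Invariant.saturation_eq_univ`).

Reducedness comes from choosing the least rank: all table entries with leader below `u` are already
present (`Invariant.lt_of_lt`), and an entry other than the first of its row is linear in its
leader, so algebraic reduction removes that leader altogether. The only derivative of `y t` that can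
exceed the bound `m t` is the one of order `d t + 1`, and only after a differentiation; the
derivatives of the lowest elements are added to the reducers to eliminate it
(`Invariant.reduced_of_algRem`).

Pseudo-reduction terminates because the degrees in the leaders of the divisors fall
lexicographically, greatest leader first. This rests on `degreeOf_pseudoRem_le`. -/

namespace DiffAlg

noncomputable section

open MvPolynomial

/-! ### Polynomials as univariate polynomials in one derivative -/

section univariate

variable {Y K : Type*} [Field K]

open Classical in
/-- A differential polynomial, regarded as a univariate polynomial in `u`. -/
def toUniv (u : Deriv Y) : DiffPoly Y K →ₐ[K] Polynomial (DiffPoly Y K) :=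
  aeval fun v => if v = u then Polynomial.X else Polynomial.C (X v)

theorem toUniv_of_notMem_vars {u : Deriv Y} {p : DiffPoly Y K} (h : u ∉ p.vars) :
    toUniv u p = Polynomial.C p := by
  have hp : p ∈ supported K {v | v ≠ u} :=
    mem_supported.mpr fun v hv hvu => h (hvu ▸ hv)
  rw [supported_eq_adjoin_X] at hp
  clear h
  induction hp using Algebra.adjoin_induction with
  | mem x hx =>
    obtain ⟨v, hv, rfl⟩ := hx
    have hv' : v ≠ u := hv
    simp [toUniv, hv']
  | algebraMap r => rw [AlgHom.commutes]; rfl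
  | add x y _ _ hx hy => rw [map_add, map_add, hx, hy]
  | mul x y _ _ hx hy => rw [map_mul, map_mul, hx, hy]

theorem toUniv_monomial (u : Deriv Y) (s : Deriv Y →₀ ℕ) (a : K) :
    toUniv u (monomial s a) =
      Polynomial.C (monomial (s.erase u) a) * Polynomial.X ^ (s u) := by
  have h : monomial s a = monomial (s.erase u) a * (X u : DiffPoly Y K) ^ (s u) := by
    rw [X_pow_eq_monomial, monomial_mul, mul_one, Finsupp.erase_add_single]
  rw [h, map_mul, map_pow, toUniv_of_notMem_vars]
  · simp [toUniv]
  · by_cases ha : a = 0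
    · simp [ha]
    · simp [vars_monomial ha]

/-- Through this identification `coeffIn` inherits the additivity and product rules of univariate
coefficients. -/
theorem coeff_toUniv (u : Deriv Y) (d : ℕ) (f : DiffPoly Y K) :
    (toUniv u f).coeff d = coeffIn u d f := by
  classical
  conv_lhs => rw [f.as_sum]
  rw [map_sum, Polynomial.finsetSum_coeff, coeffIn, Finset.sum_filter]
  refine Finset.sum_congr rfl fun s _ => ?_
  rw [toUniv_monomial, Polynomial.coeff_C_mul, Polynomial.coeff_X_pow]
  simp [eq_comm]

theorem coeff_coeffIn (u : Deriv Y) (d : ℕ) (f : DiffPoly Y K) (t : Deriv Y →₀ ℕ) :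
    (coeffIn u d f).coeff t = if t u = 0 then f.coeff (t + Finsupp.single u d) else 0 := by
  classical
  rw [coeffIn, coeff_sum]
  simp only [coeff_monomial]
  split_ifs with h
  · rw [Finset.sum_eq_single (t + Finsupp.single u d)]
    · rw [if_pos]
      ext v
      by_cases hv : v = u
      · subst hv; simp [h]
      · simp [hv]
    · intro s hs hne
      rw [if_neg]
      rintro rfl
      apply hne
      rw [Finset.mem_filter] at hs
      rw [← hs.2, Finsupp.erase_add_single]
    · intro hs
      have : f.coeff (t + Finsupp.single u d) = 0 := by
        by_contra hne
        exact hs (Finset.mem_filter.mpr ⟨mem_support_iff.mpr hne, by simp [h]⟩)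
      simp [this]
  · refine Finset.sum_eq_zero fun s _ => if_neg ?_
    rintro rfl
    exact h (by simp)

theorem coeffIn_add (u : Deriv Y) (d : ℕ) (f g : DiffPoly Y K) :
    coeffIn u d (f + g) = coeffIn u d f + coeffIn u d g := by
  simp [← coeff_toUniv]

theorem coeffIn_sub (u : Deriv Y) (d : ℕ) (f g : DiffPoly Y K) :
    coeffIn u d (f - g) = coeffIn u d f - coeffIn u d g := by
  simp [← coeff_toUniv]

theorem coeffIn_eq_zero {u : Deriv Y} {d : ℕ} {f : DiffPoly Y K} (h : f.degreeOf u < d) :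
    coeffIn u d f = 0 := by
  rw [coeffIn, Finset.filter_false_of_mem, Finset.sum_empty]
  intro s hs hd
  have := degreeOf_le_iff.mp (le_refl (f.degreeOf u)) s hs
  omega

theorem degreeOf_le_of_coeffIn {u : Deriv Y} {n : ℕ} {f : DiffPoly Y K}
    (h : ∀ d, n < d → coeffIn u d f = 0) : f.degreeOf u ≤ n := by
  rw [degreeOf_le_iff]
  intro s hs
  by_contra! hlt
  have h1 := coeff_coeffIn u (s u) f (s.erase u)
  rw [h _ hlt, Finsupp.erase_add_single] at h1
  simp only [coeff_zero, Finsupp.erase_same, if_true] at h1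
  exact mem_support_iff.mp hs h1.symm

theorem coeffIn_mul_right {u : Deriv Y} {p : DiffPoly Y K} (h : u ∉ p.vars) (d : ℕ)
    (f : DiffPoly Y K) : coeffIn u d (f * p) = coeffIn u d f * p := by
  rw [← coeff_toUniv, map_mul, toUniv_of_notMem_vars h, Polynomial.coeff_mul_C, coeff_toUniv]

theorem coeffIn_mul_left {u : Deriv Y} {p : DiffPoly Y K} (h : u ∉ p.vars) (d : ℕ)
    (f : DiffPoly Y K) : coeffIn u d (p * f) = p * coeffIn u d f := by
  rw [mul_comm, coeffIn_mul_right h, mul_comm]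

theorem notMem_vars_coeffIn (u : Deriv Y) (d : ℕ) (f : DiffPoly Y K) :
    u ∉ (coeffIn u d f).vars := by
  rw [mem_vars_iff_mem_support]
  rintro ⟨s, hs, hu⟩
  rw [mem_support_iff, coeff_coeffIn] at hs
  rw [Finsupp.mem_support_iff] at hu
  simp [hu] at hs

theorem degreeOf_coeffIn_le (u v : Deriv Y) (d : ℕ) (f : DiffPoly Y K) :
    (coeffIn u d f).degreeOf v ≤ f.degreeOf v := by
  rw [degreeOf_le_iff]
  intro t ht
  rw [mem_support_iff, coeff_coeffIn] at ht
  split_ifs at ht with h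
  · refine le_trans ?_
      (degreeOf_le_iff.mp (le_refl (f.degreeOf v)) _ (mem_support_iff.mpr ht))
    simp
  · exact absurd rfl ht

theorem vars_coeffIn_subset (u : Deriv Y) (d : ℕ) (f : DiffPoly Y K) :
    (coeffIn u d f).vars ⊆ f.vars := by
  intro v hv
  rw [mem_vars_iff_degreeOf_ne_zero] at hv ⊢
  have := degreeOf_coeffIn_le u v d f
  omega

theorem notMem_vars_pow {u : Deriv Y} {p : DiffPoly Y K} (h : u ∉ p.vars) (e : ℕ) :
    u ∉ (p ^ e).vars := fun hu => h (vars_pow p e hu)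

theorem coeffIn_mul_X_pow_mul (u : Deriv Y) (c p : DiffPoly Y K) (hc : u ∉ c.vars) (r d : ℕ) :
    coeffIn u d (c * X u ^ r * p) = if r ≤ d then c * coeffIn u (d - r) p else 0 := by
  rw [mul_assoc, coeffIn_mul_left hc, ← coeff_toUniv, map_mul, map_pow]
  have : toUniv u (X u : DiffPoly Y K) = Polynomial.X := by simp [toUniv]
  rw [this, Polynomial.coeff_X_pow_mul', coeff_toUniv]
  split_ifs <;> simp

/-- Pseudo-division of polynomials in `u`. -/
theorem exists_pseudoDivision {u : Deriv Y} {p : DiffPoly Y K} (hp : 0 < p.degreeOf u)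
    (f : DiffPoly Y K) :
    ∃ (e : ℕ) (q g : DiffPoly Y K), g.degreeOf u < p.degreeOf u ∧
      coeffIn u (p.degreeOf u) p ^ e * f = q * p + g := by
  induction hn : f.degreeOf u using Nat.strong_induction_on generalizing f with
  | _ n ih =>
  by_cases hlt : f.degreeOf u < p.degreeOf u
  · exact ⟨0, 0, f, hlt, by simp⟩
  push Not at hlt
  set I := coeffIn u (p.degreeOf u) p with hI
  set r := f.degreeOf u - p.degreeOf u with hr
  set c := coeffIn u (f.degreeOf u) f with hc
  -- The leading terms in `u` cancel. The bound is below `n`, since `n` is at least the positive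
  -- degree of `p`.
  have hdeg : (I * f - c * X u ^ r * p).degreeOf u ≤ n - 1 := by
    refine degreeOf_le_of_coeffIn fun d hd => ?_
    rw [coeffIn_sub, coeffIn_mul_left (notMem_vars_coeffIn _ _ _),
      coeffIn_mul_X_pow_mul _ _ _ (notMem_vars_coeffIn _ _ _), if_pos (by omega)]
    rcases eq_or_lt_of_le (show n ≤ d by omega) with rfl | hnd
    · rw [← hn, ← hc, show f.degreeOf u - r = p.degreeOf u by omega, ← hI]
      ring
    · rw [coeffIn_eq_zero (f := f) (by omega), coeffIn_eq_zero (f := p) (d := d - r) (by omega)]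
      ring
  obtain ⟨e, q, g, hg, he⟩ := ih _ (by omega) (I * f - c * X u ^ r * p) rfl
  refine ⟨e + 1, q + I ^ e * c * X u ^ r, g, hg, ?_⟩
  linear_combination he

/-- A pseudo-remainder has no higher degree than the dividend in an indeterminate that does not
occur in the divisor. -/
theorem degreeOf_pseudoRem_le {u v : Deriv Y} {a p f q g : DiffPoly Y K} (hva : v ∉ a.vars)
    (hv : v ∉ p.vars) (hg : g.degreeOf u < p.degreeOf u) (h : a * f = q * p + g) :
    g.degreeOf v ≤ f.degreeOf v := by
  refine degreeOf_le_of_coeffIn fun t ht => ?_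
  have h1 := congrArg (coeffIn v t) h
  rw [coeffIn_add, coeffIn_mul_left hva, coeffIn_mul_right hv, coeffIn_eq_zero ht, mul_zero] at h1
  -- The quotient is arbitrary, so its coefficient at `v ^ t` need not vanish a priori. If it did
  -- not, its product with `p` would have degree in `u` at least that of `p`, too large for a
  -- coefficient of `g`.
  by_cases hq : coeffIn v t q = 0
  · simpa [hq] using h1.symm
  · have hp : p ≠ 0 := by rintro rfl; simp at hg
    have h2 := degreeOf_mul_eq (n := u) hq hp
    have h3 : coeffIn v t q * p = - coeffIn v t g := by linear_combination -h1
    rw [h3, degreeOf_neg] at h2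
    have := degreeOf_coeffIn_le v u t g
    omega

/-- A monomial of `f` containing `u` survives differentiation, as its exponent is nonzero in
characteristic 0. -/
theorem pderiv_ne_zero [CharZero K] {f : DiffPoly Y K} {u : Deriv Y} (h : u ∈ f.vars) :
    pderiv u f ≠ 0 := by
  rw [mem_vars_iff_mem_support] at h
  obtain ⟨s, hs, hu⟩ := h
  rw [Finsupp.mem_support_iff] at hu
  intro h0
  have h1 := coeff_pderiv (i := u) f (s - Finsupp.single u 1)
  have h2 : s - Finsupp.single u 1 + Finsupp.single u 1 = s :=
    tsub_add_cancel_of_le (Finsupp.single_le_iff.mpr (by omega))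
  rw [h0, h2, coeff_zero] at h1
  have h3 := mem_support_iff.mp hs
  simp [h3] at h1
  norm_cast at h1

theorem derivation_mem_supported {f : DiffPoly Y K} {s t : Set (Deriv Y)}
    (D : Derivation K (DiffPoly Y K) (DiffPoly Y K)) (hf : f ∈ supported K s) (hst : s ⊆ t)
    (hD : ∀ v ∈ s, D (X v) ∈ supported K t) : D f ∈ supported K t := by
  rw [supported_eq_adjoin_X] at hf
  induction hf using Algebra.adjoin_induction with
  | mem x hx =>
    obtain ⟨v, hv, rfl⟩ := hx
    exact hD v hv
  | algebraMap r => rw [Derivation.map_algebraMap]; exact zero_mem _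
  | add x y _ _ hx hy => rw [map_add]; exact add_mem hx hy
  | mul x y hx' hy' hx hy =>
    rw [Derivation.leibniz]
    exact add_mem (mul_mem (supported_mono hst hx') hy) (mul_mem (supported_mono hst hy') hx)

theorem vars_pderiv_subset (u : Deriv Y) (f : DiffPoly Y K) : (pderiv u f).vars ⊆ f.vars := by
  classical
  have h : pderiv u f ∈ supported K (f.vars : Set (Deriv Y)) := by
    refine derivation_mem_supported _ (mem_supported_vars f) subset_rfl fun w _ => ?_
    rw [pderiv_X]
    by_cases hw : w = u
    · subst hw; simp [one_mem]
    · simp [Ne.symm hw, zero_mem]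
  exact fun v hv => mem_supported.mp h hv

theorem shift_injective (k : ℕ) : Function.Injective (Deriv.shift k : Deriv Y → Deriv Y) := by
  rintro ⟨a, i⟩ ⟨b, j⟩ h
  simp only [Deriv.shift, Deriv.mk.injEq] at h
  ext
  · exact h.1
  · simp only; omega

end univariate

/-! ### Leaders, ranks, initials and separants -/

section leaders

variable {Y K : Type*} [Field K] [LinearOrder (Deriv Y)]

theorem ld_eq_coe {f : DiffPoly Y K} {u : Deriv Y} :
    ld f = u ↔ u ∈ f.vars ∧ ∀ v ∈ f.vars, v ≤ u := by
  refine ⟨fun h => ⟨Finset.mem_of_max h, fun v hv => Finset.le_max_of_eq hv h⟩, fun h => ?_⟩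
  exact le_antisymm (Finset.max_le fun v hv => WithBot.coe_le_coe.mpr (h.2 v hv))
    (Finset.le_max h.1)

theorem rk_of_ld {f : DiffPoly Y K} {u : Deriv Y} (h : ld f = u) :
    rk f = (toLex (u, f.degreeOf u) : Deriv Y ×ₗ ℕ) := by
  rw [rk, h]; rfl

theorem rk_eq_coe {f : DiffPoly Y K} {u : Deriv Y} {n : ℕ} :
    rk f = (toLex (u, n) : Deriv Y ×ₗ ℕ) ↔ ld f = u ∧ f.degreeOf u = n := by
  constructor
  · intro h
    rw [rk, WithBot.map_eq_some_iff] at h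
    obtain ⟨v, hv, h⟩ := h
    have h' := Prod.ext_iff.mp (toLex.injective h)
    simp only at h'
    obtain ⟨rfl, rfl⟩ := h'
    exact ⟨hv, rfl⟩
  · rintro ⟨h, rfl⟩
    exact rk_of_ld h

theorem ld_eq_of_rk_eq {f g : DiffPoly Y K} {u : Deriv Y} (hf : ld f = u) (h : rk g = rk f) :
    ld g = u := by
  rw [rk_of_ld hf, rk_eq_coe] at h
  exact h.1

theorem degreeOf_eq_of_rk_eq {f g : DiffPoly Y K} {u : Deriv Y} (hf : ld f = u)
    (h : rk g = rk f) : g.degreeOf u = f.degreeOf u := by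
  rw [rk_of_ld hf, rk_eq_coe] at h
  exact h.2

theorem le_of_rk_le {f g : DiffPoly Y K} {u v : Deriv Y} (hf : ld f = u) (hg : ld g = v)
    (h : rk f ≤ rk g) : u ≤ v := by
  rw [rk_of_ld hf, rk_of_ld hg, WithBot.coe_le_coe, Prod.Lex.toLex_le_toLex] at h
  rcases h with h | h
  · exact h.le
  · exact h.1.le

theorem rk_le_of_lt {f g : DiffPoly Y K} {u v : Deriv Y} (hf : ld f = u) (hg : ld g = v)
    (h : u < v) : rk f ≤ rk g := by
  rw [rk_of_ld hf, rk_of_ld hg, WithBot.coe_le_coe, Prod.Lex.toLex_le_toLex]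
  exact Or.inl h

theorem lv_of_ld {f : DiffPoly Y K} {u : Deriv Y} (h : ld f = u) : lv f = u.var := by
  rw [lv, h]; rfl

theorem initial_of_ld {f : DiffPoly Y K} {u : Deriv Y} (h : ld f = u) :
    initial f = coeffIn u (f.degreeOf u) f := by
  rw [initial, h]; rfl

theorem separant_of_ld {f : DiffPoly Y K} {u : Deriv Y} (h : ld f = u) :
    separant f = pderiv u f := by
  rw [separant, h]; rfl

theorem degreeOf_pos_of_ld {f : DiffPoly Y K} {u : Deriv Y} (h : ld f = u) :
    0 < f.degreeOf u :=
  Nat.pos_of_ne_zero (mem_vars_iff_degreeOf_ne_zero.mp (ld_eq_coe.mp h).1)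

theorem vars_initial_subset {f : DiffPoly Y K} {u : Deriv Y} (h : ld f = u) :
    (initial f).vars ⊆ f.vars := by
  rw [initial_of_ld h]
  exact vars_coeffIn_subset _ _ _

end leaders

/-! ### Rankings and the leader of a derivative -/

section derivatives

variable {Y K : Type*} [Field K] [Differential K]

theorem vars_coeffDeriv_subset (f : DiffPoly Y K) : (coeffDeriv f).vars ⊆ f.vars := by
  intro v hv
  rw [mem_vars_iff_mem_support] at hv ⊢
  obtain ⟨s, hs, hv⟩ := hv
  refine ⟨s, ?_, hv⟩
  rw [mem_support_iff, coeff_coeffDeriv] at hs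
  rw [mem_support_iff]
  rintro h
  simp [h] at hs

open Classical in
/-- The derivative of `f` splits into the term with `δ u` and a rest that contains only
indeterminates of `f` and derivatives of indeterminates other than `u`. -/
theorem exists_δ_eq (u : Deriv Y) (f : DiffPoly Y K) :
    ∃ r : DiffPoly Y K, δ f = pderiv u f * X (u.shift 1) + r ∧
      ∀ v ∈ r.vars, v ∈ f.vars ∨ ∃ w ∈ f.vars, w ≠ u ∧ v = w.shift 1 := by
  set D : Derivation K (DiffPoly Y K) (DiffPoly Y K) :=
    mkDerivation K fun v => if v = u then 0 else X (v.shift 1) with hD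
  have hsplit : (mkDerivation K fun v : Deriv Y => (X (v.shift 1) : DiffPoly Y K)) =
      (X (u.shift 1) : DiffPoly Y K) • pderiv u + D := by
    refine derivation_ext fun v => ?_
    by_cases hv : v = u
    · subst hv
      simp [hD, mkDerivation_X]
    · simp [hD, mkDerivation_X, hv, pderiv_X_of_ne hv]
  refine ⟨coeffDeriv f + D f, ?_, ?_⟩
  · change coeffDeriv f + mkDerivation K _ f = _
    rw [hsplit]
    simp only [Derivation.add_apply, Derivation.smul_apply, smul_eq_mul]
    ring
  · set t : Set (Deriv Y) := {v | v ∈ f.vars ∨ ∃ w ∈ f.vars, w ≠ u ∧ v = w.shift 1} with ht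
    have hsub : (f.vars : Set (Deriv Y)) ⊆ t := fun v hv => Or.inl hv
    have h1 : D f ∈ supported K t := by
      refine derivation_mem_supported D (mem_supported_vars f) hsub fun v hv => ?_
      rw [hD, mkDerivation_X]
      split_ifs with hvu
      · exact zero_mem _
      · exact X_mem_supported.mpr (Or.inr ⟨v, hv, hvu, rfl⟩)
    have h2 : coeffDeriv f ∈ supported K t :=
      mem_supported.mpr fun v hv => hsub (vars_coeffDeriv_subset f hv)
    exact fun v hv => mem_supported.mp (add_mem h2 h1) hv

theorem mem_vars_δ {f : DiffPoly Y K} {v : Deriv Y} (h : v ∈ (δ f).vars) :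
    v ∈ f.vars ∨ ∃ w ∈ f.vars, v = w.shift 1 := by
  classical
  by_cases hf : f.vars = ∅
  · obtain ⟨r, hr, hvr⟩ := exists_δ_eq v f
    rw [pderiv_eq_zero_of_notMem_vars (by simp [hf]), zero_mul, zero_add] at hr
    rw [hr] at h
    exact (hvr v h).imp_right fun ⟨w, hw, _, e⟩ => ⟨w, hw, e⟩
  · obtain ⟨u, hu⟩ := Finset.nonempty_iff_ne_empty.mpr hf
    obtain ⟨r, hr, hvr⟩ := exists_δ_eq u f
    rw [hr] at h
    rcases Finset.mem_union.mp (vars_add_subset _ _ h) with h | h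
    · rcases Finset.mem_union.mp (vars_mul _ _ h) with h | h
      · exact Or.inl (vars_pderiv_subset u f h)
      · rw [vars_X, Finset.mem_singleton] at h
        exact Or.inr ⟨u, hu, h⟩
    · exact (hvr v h).imp_right fun ⟨w, hw, _, e⟩ => ⟨w, hw, e⟩

variable [LinearOrder (Deriv Y)]

theorem IsRanking.shift_lt_shift (hR : IsRanking Y) {u v : Deriv Y} (h : u < v) (k : ℕ) :
    u.shift k < v.shift k :=
  lt_of_le_of_ne (hR.shift_le_shift k v u h.le) fun e => h.ne (shift_injective k e)

theorem IsRanking.mk_le_mk (hR : IsRanking Y) {y : Y} {i j : ℕ} :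
    (⟨y, i⟩ : Deriv Y) ≤ ⟨y, j⟩ ↔ i ≤ j := by
  have key : ∀ a b : ℕ, a ≤ b → (⟨y, a⟩ : Deriv Y) ≤ ⟨y, b⟩ := by
    intro a b hab
    have := hR.le_shift (b - a) ⟨y, a⟩
    rwa [Deriv.shift, show a + (b - a) = b by omega] at this
  refine ⟨fun h => ?_, key i j⟩
  by_contra! hlt
  have := le_antisymm h (key j i hlt.le)
  rw [Deriv.mk.injEq] at this
  omega

theorem IsRanking.lt_shift_one (hR : IsRanking Y) (u : Deriv Y) : u < u.shift 1 := by
  refine lt_of_le_of_ne (hR.le_shift 1 u) fun e => ?_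
  have := congrArg Deriv.ord e
  simp [Deriv.shift] at this

/-- The derivative of a polynomial with leader `u` is linear in `δ u`, its separant is the
coefficient. -/
theorem exists_δ_eq_separant_mul (hR : IsRanking Y) {f : DiffPoly Y K} {u : Deriv Y}
    (h : ld f = u) : ∃ r : DiffPoly Y K, δ f = separant f * X (u.shift 1) + r ∧
      (∀ v ∈ (separant f).vars, v < u.shift 1) ∧ ∀ v ∈ r.vars, v < u.shift 1 := by
  classical
  obtain ⟨hu, hle⟩ := ld_eq_coe.mp h
  obtain ⟨r, hr, hv⟩ := exists_δ_eq u f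
  refine ⟨r, by rw [hr, separant_of_ld h], fun v hv => ?_, fun v hvr => ?_⟩
  · rw [separant_of_ld h] at hv
    exact (hle v (vars_pderiv_subset u f hv)).trans_lt (hR.lt_shift_one u)
  · rcases hv v hvr with hf | ⟨w, hw, hne, rfl⟩
    · exact (hle v hf).trans_lt (hR.lt_shift_one u)
    · exact hR.shift_lt_shift (lt_of_le_of_ne (hle w hw) hne) 1

/-- Neither the separant nor the remaining part of `δ f` contains `δ u`. Leader, degree and initial
of `δ f` are read off from this. -/
theorem coeffIn_δ (hR : IsRanking Y) {f : DiffPoly Y K} {u : Deriv Y} (h : ld f = u) {d : ℕ}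
    (hd : 0 < d) : coeffIn (u.shift 1) d (δ f) = if d = 1 then separant f else 0 := by
  obtain ⟨r, hr, hs, hv⟩ := exists_δ_eq_separant_mul hR h
  have h1 : u.shift 1 ∉ (separant f).vars := fun h => (hs _ h).false
  have h2 : u.shift 1 ∉ r.vars := fun h => (hv _ h).false
  have h3 : r.degreeOf (u.shift 1) = 0 := by
    simpa [mem_vars_iff_degreeOf_ne_zero] using h2
  have h4 := coeffIn_mul_X_pow_mul (u.shift 1) (separant f) 1 h1 1 d
  rw [pow_one, mul_one, if_pos (by omega)] at h4
  rw [hr, coeffIn_add, coeffIn_eq_zero (f := r) (by omega), add_zero, h4]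
  split_ifs with hd1
  · subst hd1
    rw [← coeff_toUniv]
    simp
  · rw [coeffIn_eq_zero (d := d - 1), mul_zero]
    rw [degreeOf_one]; omega

variable [CharZero K]

theorem ld_δ (hR : IsRanking Y) {f : DiffPoly Y K} {u : Deriv Y} (h : ld f = u) :
    ld (δ f) = (u.shift 1 : Deriv Y) := by
  obtain ⟨hu, hle⟩ := ld_eq_coe.mp h
  rw [ld_eq_coe]
  constructor
  · have h1 := coeffIn_δ hR h one_pos
    rw [mem_vars_iff_degreeOf_ne_zero]
    intro h0
    rw [coeffIn_eq_zero (by omega), if_pos rfl, separant_of_ld h] at h1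
    exact pderiv_ne_zero hu h1.symm
  · intro v hv
    rcases mem_vars_δ hv with hf | ⟨w, hw, rfl⟩
    · exact (hle v hf).trans (hR.le_shift 1 u)
    · exact hR.shift_le_shift 1 u w (hle w hw)

theorem degreeOf_δ (hR : IsRanking Y) {f : DiffPoly Y K} {u : Deriv Y} (h : ld f = u) :
    (δ f).degreeOf (u.shift 1) = 1 := by
  refine le_antisymm (degreeOf_le_of_coeffIn fun d hd => ?_) (degreeOf_pos_of_ld (ld_δ hR h))
  rw [coeffIn_δ hR h (by omega), if_neg (by omega)]

theorem initial_δ (hR : IsRanking Y) {f : DiffPoly Y K} {u : Deriv Y} (h : ld f = u) :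
    initial (δ f) = separant f := by
  rw [initial_of_ld (ld_δ hR h), degreeOf_δ hR h, coeffIn_δ hR h one_pos, if_pos rfl]

theorem separant_δ (hR : IsRanking Y) {f : DiffPoly Y K} {u : Deriv Y} (h : ld f = u) :
    separant (δ f) = separant f := by
  obtain ⟨r, hr, hs, hv⟩ := exists_δ_eq_separant_mul hR h
  rw [separant_of_ld (ld_δ hR h), hr, map_add, pderiv_mul, pderiv_X_self,
    pderiv_eq_zero_of_notMem_vars (f := r) fun h => (hv _ h).false,
    pderiv_eq_zero_of_notMem_vars (f := separant f) fun h => (hs _ h).false]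
  ring

theorem rk_δ (hR : IsRanking Y) {f : DiffPoly Y K} {u : Deriv Y} (h : ld f = u) :
    rk (δ f) = (toLex (u.shift 1, 1) : Deriv Y ×ₗ ℕ) :=
  rk_eq_coe.mpr ⟨ld_δ hR h, degreeOf_δ hR h⟩

theorem ld_δ_iterate (hR : IsRanking Y) {f : DiffPoly Y K} {y : Y} {d : ℕ}
    (h : ld f = (⟨y, d⟩ : Deriv Y)) (j : ℕ) :
    ld (δ^[j] f) = (⟨y, d + j⟩ : Deriv Y) := by
  induction j with
  | zero => exact h
  | succ j ih => rw [Function.iterate_succ_apply', ld_δ hR ih]; rfl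

end derivatives

/-! ### Multiplicative sets, saturations and differential ideals -/

section ideals

variable {Y K : Type*} [Field K]

theorem subset_powers (H : Set (DiffPoly Y K)) : H ⊆ powers H := Submonoid.subset_closure

theorem one_mem_powers (H : Set (DiffPoly Y K)) : 1 ∈ powers H := (Submonoid.closure H).one_mem

theorem mul_mem_powers {H : Set (DiffPoly Y K)} {a b : DiffPoly Y K} (ha : a ∈ powers H)
    (hb : b ∈ powers H) : a * b ∈ powers H := (Submonoid.closure H).mul_mem ha hb

theorem powers_mono {H G : Set (DiffPoly Y K)} (h : H ⊆ G) : powers H ⊆ powers G :=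
  Submonoid.closure_mono h

theorem mem_powers_add {H : Set (DiffPoly Y K)} {I : Ideal (DiffPoly Y K)} {a : DiffPoly Y K} :
    a ∈ powers H + (I : Set (DiffPoly Y K)) ↔ ∃ h ∈ powers H, a - h ∈ I := by
  rw [Set.mem_add]
  constructor
  · rintro ⟨h, hh, b, hb, rfl⟩
    exact ⟨h, hh, by simpa using hb⟩
  · rintro ⟨h, hh, hb⟩
    exact ⟨h, hh, a - h, hb, by ring⟩

theorem powers_subset_powers_add (H : Set (DiffPoly Y K)) (I : Ideal (DiffPoly Y K)) :
    powers H ⊆ powers H + (I : Set (DiffPoly Y K)) := fun h hh =>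
  mem_powers_add.mpr ⟨h, hh, by simp⟩

theorem mul_mem_powers_add {H : Set (DiffPoly Y K)} {I : Ideal (DiffPoly Y K)}
    {a b : DiffPoly Y K} (ha : a ∈ powers H + (I : Set (DiffPoly Y K)))
    (hb : b ∈ powers H + (I : Set (DiffPoly Y K))) :
    a * b ∈ powers H + (I : Set (DiffPoly Y K)) := by
  rw [mem_powers_add] at ha hb ⊢
  obtain ⟨h, hh, ha⟩ := ha
  obtain ⟨g, hg, hb⟩ := hb
  refine ⟨h * g, mul_mem_powers hh hg, ?_⟩
  have : a * b - h * g = b * (a - h) + h * (b - g) := by ring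
  rw [this]
  exact I.add_mem (I.mul_mem_left _ ha) (I.mul_mem_left _ hb)

theorem mem_powers_add_of_sub_mem {H : Set (DiffPoly Y K)} {I : Ideal (DiffPoly Y K)}
    {a b : DiffPoly Y K} (ha : a ∈ powers H + (I : Set (DiffPoly Y K))) (hab : a - b ∈ I) :
    b ∈ powers H + (I : Set (DiffPoly Y K)) := by
  rw [mem_powers_add] at ha ⊢
  obtain ⟨h, hh, ha⟩ := ha
  refine ⟨h, hh, ?_⟩
  have : b - h = (a - h) - (a - b) := by ring
  rw [this]
  exact I.sub_mem ha hab

/-- `H^∞ + I` is closed under multiplication, so generators suffice. -/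
theorem powers_subset_powers_add_of_subset {G H : Set (DiffPoly Y K)}
    {I : Ideal (DiffPoly Y K)} (h : G ⊆ powers H + (I : Set (DiffPoly Y K))) :
    powers G ⊆ powers H + (I : Set (DiffPoly Y K)) := by
  intro a ha
  induction ha using Submonoid.closure_induction with
  | mem x hx => exact h hx
  | one => exact powers_subset_powers_add H I (one_mem_powers H)
  | mul x y _ _ hx hy => exact mul_mem_powers_add hx hy

/-- The element `h` of `H^∞` congruent to `a` lies in `I` as well, and it multiplies everything into
`I`. -/
theorem saturation_eq_univ_of_mem {H : Set (DiffPoly Y K)} {I : Ideal (DiffPoly Y K)}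
    {a : DiffPoly Y K} (ha : a ∈ powers H + (I : Set (DiffPoly Y K))) (haI : a ∈ I) :
    saturation (I : Set (DiffPoly Y K)) H = Set.univ := by
  rw [mem_powers_add] at ha
  obtain ⟨h, hh, ha⟩ := ha
  have hI : h ∈ I := by simpa using I.sub_mem haI ha
  exact Set.eq_univ_of_forall fun b => ⟨h, hh, I.mul_mem_right b hI⟩

theorem saturation_mono {A A' S S' : Set (DiffPoly Y K)} (hA : A ⊆ A') (hS : S ⊆ S') :
    saturation A S ⊆ saturation A' S' := by
  rintro a ⟨s, hs, ha⟩
  exact ⟨s, powers_mono hS hs, hA ha⟩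

/-- Finiteness bounds the orders; an unbounded set of naturals would have supremum 0. -/
theorem ord_le_maxOrd {F : Set (DiffPoly Y K)} (hF : F.Finite) {f : DiffPoly Y K} (hf : f ∈ F)
    {v : Y} {e : ℕ} (h : (⟨v, e⟩ : Deriv Y) ∈ f.vars) : e ≤ maxOrd v F := by
  refine le_csSup ?_ ⟨f, hf, h⟩
  have : (⋃ f ∈ F, (Deriv.ord '' (f.vars : Set (Deriv Y)))).Finite :=
    hF.biUnion fun f _ => f.vars.finite_toSet.image _
  refine this.bddAbove.mono ?_
  rintro j ⟨f, hf, hj⟩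
  exact Set.mem_biUnion hf ⟨_, hj, rfl⟩

variable [Differential K]

theorem subset_diffIdeal (F : Set (DiffPoly Y K)) : F ⊆ diffIdeal F := fun f hf => by
  rw [SetLike.mem_coe, diffIdeal, Submodule.mem_sInf]
  exact fun I hI => hI.1 hf

theorem δ_mem_diffIdeal {F : Set (DiffPoly Y K)} {f : DiffPoly Y K} (hf : f ∈ diffIdeal F) :
    δ f ∈ diffIdeal F := by
  rw [diffIdeal, Submodule.mem_sInf] at hf ⊢
  exact fun I hI => hI.2 f (hf I hI)

theorem diffIdeal_le {F : Set (DiffPoly Y K)} {I : Ideal (DiffPoly Y K)} (h : F ⊆ I)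
    (hδ : ∀ f ∈ I, δ f ∈ I) : diffIdeal F ≤ I :=
  sInf_le ⟨h, hδ⟩

theorem diffIdeal_le_of_subset {F G : Set (DiffPoly Y K)} (h : F ⊆ diffIdeal G) :
    diffIdeal F ≤ diffIdeal G :=
  diffIdeal_le h fun _ => δ_mem_diffIdeal

theorem diffIdeal_mono {F G : Set (DiffPoly Y K)} (h : F ⊆ G) : diffIdeal F ≤ diffIdeal G :=
  diffIdeal_le_of_subset (h.trans (subset_diffIdeal G))

/-- A differential ideal saturated by a multiplicative set is a differential ideal. -/
theorem diffIdeal_subset_saturation {F G H : Set (DiffPoly Y K)}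
    (h : F ⊆ saturation (diffIdeal G) H) :
    (diffIdeal F : Set (DiffPoly Y K)) ⊆ saturation (diffIdeal G) H := by
  let I : Ideal (DiffPoly Y K) :=
    { carrier := saturation (diffIdeal G) H
      add_mem' := by
        rintro a b ⟨s, hs, ha⟩ ⟨t, ht, hb⟩
        refine ⟨s * t, mul_mem_powers hs ht, ?_⟩
        have : s * t * (a + b) = t * (s * a) + s * (t * b) := by ring
        rw [this]
        exact add_mem (Ideal.mul_mem_left _ _ ha) (Ideal.mul_mem_left _ _ hb)
      zero_mem' := ⟨1, one_mem_powers H, by simp⟩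
      smul_mem' := by
        rintro c a ⟨s, hs, ha⟩
        refine ⟨s, hs, ?_⟩
        have : s * c • a = c * (s * a) := by rw [smul_eq_mul]; ring
        rw [this]
        exact Ideal.mul_mem_left _ _ ha }
  refine diffIdeal_le (I := I) h ?_
  rintro f ⟨s, hs, hf⟩
  -- Leibniz on `s f` leaves the error term `f δ s`; a second factor `s` turns it into a multiple of
  -- `s f`.
  refine ⟨s * s, mul_mem_powers hs hs, ?_⟩
  have h1 := δ_mem_diffIdeal hf
  rw [Derivation.leibniz, smul_eq_mul, smul_eq_mul] at h1
  have : s * s * δ f = s * (s * δ f + f * δ s) - δ s * (s * f) := by ring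
  rw [this]
  exact sub_mem (Ideal.mul_mem_left _ _ h1) (Ideal.mul_mem_left _ _ hf)

end ideals

/-! ### Successive pseudo-divisions: congruences and termination -/

section pseudoDivision

variable {Y K : Type*} [Field K] [LinearOrder (Deriv Y)]

theorem initSep_mono {F G : Set (DiffPoly Y K)} (h : F ⊆ G) : initSep F ⊆ initSep G :=
  Set.union_subset_union (Set.image_mono h) (Set.image_mono h)

theorem initial_mem_initSep {F : Set (DiffPoly Y K)} {f : DiffPoly Y K} (h : f ∈ F) :
    initial f ∈ initSep F := Or.inl ⟨f, h, rfl⟩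

theorem separant_mem_initSep {F : Set (DiffPoly Y K)} {f : DiffPoly Y K} (h : f ∈ F) :
    separant f ∈ initSep F := Or.inr ⟨f, h, rfl⟩

/-- The degree in a derivative absent from the divisor cannot grow, so it cannot become positive. -/
theorem PseudoDivision.mem_vars {S : Set (DiffPoly Y K)} {f g : DiffPoly Y K} {v : Deriv Y}
    (h : PseudoDivision S f g) (hv : v ∈ g.vars) :
    v ∈ f.vars ∨ ∃ p ∈ S, v ∈ p.vars := by
  obtain ⟨p, hp, w, hw, -, hg, e, q, he⟩ := h
  by_cases hvp : v ∈ p.vars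
  · exact Or.inr ⟨p, hp, hvp⟩
  · left
    have := degreeOf_pseudoRem_le
      (notMem_vars_pow (fun h => hvp (vars_initial_subset hw h)) e) hvp hg he
    rw [mem_vars_iff_degreeOf_ne_zero] at hv ⊢
    omega

/-- Effect of successive pseudo-divisions by elements whose leaders differ from the upper bound `u`
of the indeterminates of `f`, on the coefficients w.r.t. `u` and on the derivative w.r.t. `u`. -/
theorem exists_mul_sub_mem_of_pseudoDivisions {S : Set (DiffPoly Y K)} {f g : DiffPoly Y K}
    {u : Deriv Y} (hS : ∀ p ∈ S, ld p ≠ u) (hf : ∀ v ∈ f.vars, v ≤ u)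
    (h : Relation.ReflTransGen (PseudoDivision S) f g) :
    (∀ v ∈ g.vars, v ≤ u) ∧ (∀ v ∈ g.vars, v ∈ f.vars ∨ ∃ p ∈ S, v ∈ p.vars) ∧
      g.degreeOf u ≤ f.degreeOf u ∧
      ∃ a ∈ powers (initial '' S), a * f - g ∈ Ideal.span S ∧
        (∀ t, a * coeffIn u t f - coeffIn u t g ∈ Ideal.span S) ∧
        a * pderiv u f - pderiv u g ∈ Ideal.span S := by
  induction h with
  | refl =>
    exact ⟨hf, fun v hv => Or.inl hv, le_rfl, 1, one_mem_powers _, by simp, by simp, by simp⟩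
  | @tail b c _ hstep ih =>
    obtain ⟨hb, hbv, hbd, a, ha, h1, h2, h3⟩ := ih
    have hcv := fun v => hstep.mem_vars (v := v)
    obtain ⟨p, hp, w, hw, hdeg, hg, e, q, he⟩ := hstep
    have hwp := degreeOf_pos_of_ld hw
    have hwb : w ∈ b.vars := mem_vars_iff_degreeOf_ne_zero.mpr (by omega)
    -- A division takes place only if the leader `w` of the divisor occurs in the dividend. Hence `w
    -- < u`, and the divisor and its initial are constants with respect to `u`.
    have hwu : w < u := lt_of_le_of_ne (hb w hwb) fun e => hS p hp (e ▸ hw)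
    have hpu : ∀ v ∈ p.vars, v < u := fun v hv => ((ld_eq_coe.mp hw).2 v hv).trans_lt hwu
    have hup : u ∉ p.vars := fun h => (hpu u h).false
    have hui : u ∉ (initial p ^ e).vars :=
      notMem_vars_pow (fun h => hup (vars_initial_subset hw h)) e
    have hpS : p ∈ Ideal.span S := Ideal.subset_span hp
    have hle : ∀ v ∈ c.vars, v ≤ u := by
      intro v hv
      by_cases hvp : v ∈ p.vars
      · exact (hpu v hvp).le
      · have := degreeOf_pseudoRem_le
          (notMem_vars_pow (fun h => hvp (vars_initial_subset hw h)) e) hvp hg he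
        refine hb v ?_
        rw [mem_vars_iff_degreeOf_ne_zero] at hv ⊢
        omega
    refine ⟨hle, ?_, (degreeOf_pseudoRem_le hui hup hg he).trans hbd,
      initial p ^ e * a, ?_, ?_, ?_, ?_⟩
    · intro v hv
      rcases hcv v hv with h | h
      · exact hbv v h
      · exact Or.inr h
    · exact mul_mem_powers ((Submonoid.closure _).pow_mem (subset_powers _ (Set.mem_image_of_mem _ hp)) e) ha
    · have : initial p ^ e * a * f - c = initial p ^ e * (a * f - b) + q * p := by
        linear_combination he
      rw [this]
      exact add_mem (Ideal.mul_mem_left _ _ h1) (Ideal.mul_mem_left _ _ hpS)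
    · intro t
      have he' := congrArg (coeffIn u t) he
      rw [coeffIn_add, coeffIn_mul_left hui, coeffIn_mul_right hup] at he'
      have : initial p ^ e * a * coeffIn u t f - coeffIn u t c =
          initial p ^ e * (a * coeffIn u t f - coeffIn u t b) + coeffIn u t q * p := by
        linear_combination he'
      rw [this]
      exact add_mem (Ideal.mul_mem_left _ _ (h2 t)) (Ideal.mul_mem_left _ _ hpS)
    · have he' := congrArg (pderiv u) he
      rw [map_add, pderiv_mul, pderiv_mul, pderiv_eq_zero_of_notMem_vars hup,
        pderiv_eq_zero_of_notMem_vars hui] at he'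
      have : initial p ^ e * a * pderiv u f - pderiv u c =
          initial p ^ e * (a * pderiv u f - pderiv u b) + pderiv u q * p := by
        linear_combination he'
      rw [this]
      exact add_mem (Ideal.mul_mem_left _ _ h3) (Ideal.mul_mem_left _ _ hpS)

theorem exists_pseudoDivision_of_not_algReduced {S : Set (DiffPoly Y K)} {f p : DiffPoly Y K}
    (hp : p ∈ S) (h : ¬ AlgReduced f p) : ∃ g, PseudoDivision S f g := by
  simp only [AlgReduced, not_forall, not_lt] at h
  obtain ⟨u, hu, hle⟩ := h
  obtain ⟨e, q, g, hg, he⟩ := exists_pseudoDivision (degreeOf_pos_of_ld hu) f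
  exact ⟨g, p, hp, u, hu, hle, hg, e, q, by rw [initial_of_ld hu, he]⟩

/-- Successive pseudo-divisions by the elements of a finite set terminate. -/
theorem wellFounded_pseudoDivision {S : Set (DiffPoly Y K)} (hS : S.Finite) :
    WellFounded fun g f => PseudoDivision S f g := by
  let L : Set (Deriv Y) := {u | ∃ p ∈ S, ld p = u}
  have hL : L.Finite := by
    refine Set.Finite.of_finite_image ((hS.image ld).subset ?_) WithBot.coe_injective.injOn
    rintro _ ⟨u, ⟨p, hp, hu⟩, rfl⟩
    exact ⟨p, hp, hu⟩
  have : Finite L := hL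
  -- The index order is reversed so that the degree in the greatest leader is compared first.
  have hwf : WellFounded (Pi.Lex (fun a b : L => b < a)
      (fun {_} (a b : ℕ) => a < b)) :=
    Pi.Lex.wellFounded (ι := L) (α := fun _ => ℕ) (s := fun _ => (· < ·)) (fun a b : L => b < a)
      fun _ => wellFounded_lt
  refine Subrelation.wf ?_
    (InvImage.wf (fun f : DiffPoly Y K => fun w : L => f.degreeOf w.1) hwf)
  rintro g f ⟨p, hp, u, hu, hdeg, hg, e, q, he⟩
  have hle : ∀ v : L, u < v.1 → g.degreeOf v.1 ≤ f.degreeOf v.1 := by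
    intro v hv
    have hvp : v.1 ∉ p.vars := fun h => ((ld_eq_coe.mp hu).2 _ h).not_gt hv
    exact degreeOf_pseudoRem_le
      (notMem_vars_pow (fun h => hvp (vars_initial_subset hu h)) e) hvp hg he
  -- At the greatest leader `w` where the degrees differ, the degree falls: by the division itself
  -- if `w = u`, and because `w` does not occur in the divisor if `w > u`.
  obtain ⟨w, hw, hmax⟩ := Set.exists_max_image {v : L | g.degreeOf v.1 ≠ f.degreeOf v.1} id
    (Set.toFinite _) ⟨⟨u, p, hp, hu⟩, by simp only [Set.mem_ofPred_eq]; omega⟩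
  have huw : u ≤ w.1 := hmax ⟨u, p, hp, hu⟩ (by simp only [Set.mem_ofPred_eq]; omega)
  refine ⟨w, fun v hv => ?_, ?_⟩
  · by_contra hne
    exact (hmax v hne).not_gt hv
  · rcases huw.eq_or_lt with rfl | hlt
    · exact hg.trans_le hdeg
    · exact lt_of_le_of_ne (hle w hlt) hw

theorem algRemTerminates_of_finite {S : Set (DiffPoly Y K)} (hS : S.Finite)
    (f : DiffPoly Y K) : AlgRemTerminates S f := by
  intro g _
  by_contra! h
  obtain ⟨_, ⟨j, rfl⟩, hmin⟩ :=
    (wellFounded_pseudoDivision hS).has_min (Set.range g) (Set.range_nonempty g)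
  exact hmin (g (j + 1)) ⟨j + 1, rfl⟩ (h j)

theorem exists_algRem {S : Set (DiffPoly Y K)} (hS : S.Finite) (f : DiffPoly Y K) :
    ∃ g, AlgRem S f g := by
  induction f using (wellFounded_pseudoDivision hS).induction with
  | _ f ih =>
  by_cases h : ∀ p ∈ S, AlgReduced f p
  · exact ⟨f, .refl, h⟩
  · push Not at h
    obtain ⟨p, hp, hred⟩ := h
    obtain ⟨f', hf'⟩ := exists_pseudoDivision_of_not_algReduced hp hred
    obtain ⟨g, hg, hgr⟩ := ih f' hf'
    exact ⟨g, .head hf' hg, hgr⟩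

end pseudoDivision

/-! ### The loop invariant and the choice of the next element -/

section invariant

variable {Y K : Type*} [Field K] [LinearOrder (Deriv Y)]

/-- The requirements on the input of the algorithm. -/
structure IsInput {k : ℕ} (C : Fin k → DiffPoly Y K) (y : Fin k → Y) (d m : Fin k → ℕ) : Prop where
  ranking : IsRanking Y
  ld_C : ∀ i, ld (C i) = (⟨y i, d i⟩ : Deriv Y)
  injective : Function.Injective y
  ord_le : ∀ i t e, (⟨y t, e⟩ : Deriv Y) ∈ (C i).vars → e ≤ m t

section

variable {k : ℕ} {C : Fin k → DiffPoly Y K} {y : Fin k → Y} {d m : Fin k → ℕ}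

theorem IsInput.d_le (hI : IsInput C y d m) (i : Fin k) : d i ≤ m i :=
  hI.ord_le i i (d i) (ld_eq_coe.mp (hI.ld_C i)).1

theorem IsInput.ord_le_of_reduced (hI : IsInput C y d m) {b : DiffPoly Y K} {t : Fin k}
    (hred : Reduced b (C t)) {e : ℕ} (h : (⟨y t, e⟩ : Deriv Y) ∈ b.vars) : e ≤ d t := by
  by_contra! hlt
  refine hred.1 _ (hI.ld_C t) (e - d t) (by omega) ?_
  rwa [Deriv.shift, show d t + (e - d t) = e by omega]

end

variable [Differential K]

/-- The loop invariant: `n i` elements with leading indeterminate `y i` have been computed. -/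
structure Invariant {k : ℕ} (C : Fin k → DiffPoly Y K) (y : Fin k → Y) (d m : Fin k → ℕ)
    (D B : Set (DiffPoly Y K)) (n : Fin k → ℕ) : Prop where
  mem_D : ∀ f, f ∈ D ↔ ∃ i, n i = 0 ∧ f = C i
  n_le : ∀ i, n i ≤ m i - d i + 1
  finite : B.Finite
  exists_ld : ∀ i j, j < n i → ∃ b ∈ B, ld b = (⟨y i, d i + j⟩ : Deriv Y)
  mem_B : ∀ b ∈ B, ∃ i j, j < n i ∧ rk b = rk (δ^[j] (C i)) ∧ ∀ t, t ≠ i → Reduced b (C t)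
  injOn : Set.InjOn ld B
  ord_le : ∀ b ∈ B, ∀ v ∉ Set.range y, ∀ e, (⟨v, e⟩ : Deriv Y) ∈ b.vars →
    e ≤ maxOrd v (Set.range C) + ∑ i, (n i - 1)
  subset_lowest : B ⊆ diffIdeal (lowest B)
  subset_diffIdeal : B ⊆ diffIdeal (Set.range C)
  initSep_subset : initSep B ⊆
    powers (initSep (Set.range C)) + (diffIdeal (Set.range C) : Set (DiffPoly Y K))
  mem_saturation : ∀ i, 0 < n i → C i ∈ saturation (diffIdeal B) (initSep B) ∧
    initial (C i) ∈ saturation (powers (initSep B) + (diffIdeal B : Set (DiffPoly Y K)))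
      (initSep B) ∧
    separant (C i) ∈ saturation (powers (initSep B) + (diffIdeal B : Set (DiffPoly Y K)))
      (initSep B)

variable {k : ℕ} {C : Fin k → DiffPoly Y K} {y : Fin k → Y} {d m : Fin k → ℕ}
  {D B : Set (DiffPoly Y K)} {n : Fin k → ℕ}

/-- The two forms of an element chosen in an iteration: an input polynomial, or the derivative of
the last computed element with leading indeterminate `y i`. -/
def IsChosen (C : Fin k → DiffPoly Y K) (y : Fin k → Y) (d : Fin k → ℕ)
    (D B : Set (DiffPoly Y K)) (n : Fin k → ℕ) (f : DiffPoly Y K) (i : Fin k) : Prop :=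
  (n i = 0 ∧ f = C i ∧ f ∈ D) ∨ (0 < n i ∧ f ∉ D ∧
    ∃ b ∈ B, ld b = (⟨y i, d i + (n i - 1)⟩ : Deriv Y) ∧ f = δ b)

theorem invariant_init (C : Fin k → DiffPoly Y K) (y : Fin k → Y) (d m : Fin k → ℕ) :
    Invariant C y d m (Set.range C) ∅ 0 where
  mem_D f := by simp [eq_comm]
  n_le i := Nat.zero_le _
  finite := Set.finite_empty
  exists_ld i j h := absurd h (Nat.not_lt_zero _)
  mem_B b h := h.elim
  injOn := Set.injOn_empty _
  ord_le b h := h.elim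
  subset_lowest := Set.empty_subset _
  subset_diffIdeal := Set.empty_subset _
  initSep_subset := by simp [initSep]
  mem_saturation i h := absurd h (Nat.not_lt_zero _)

namespace Invariant

theorem rk_le_rk (hI : IsInput C y d m) (hV : Invariant C y d m D B n)
    {b c : DiffPoly Y K} (hb : b ∈ B) (hc : c ∈ B) {v : Y} {e e' : ℕ}
    (hbl : ld b = (⟨v, e⟩ : Deriv Y)) (hcl : ld c = (⟨v, e'⟩ : Deriv Y)) (h : e ≤ e') :
    rk b ≤ rk c := by
  rcases h.eq_or_lt with rfl | h
  · rw [hV.injOn hb hc (hbl.trans hcl.symm)]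
  · refine rk_le_of_lt hbl hcl (lt_of_not_ge fun hle => ?_)
    have := hI.ranking.mk_le_mk.mp hle
    omega

theorem finite_reducers (hV : Invariant C y d m D B n) (f : DiffPoly Y K) :
    (reducers D B f).Finite := by
  have hlow : (lowest B).Finite := hV.finite.subset fun b hb => hb.1
  rw [reducers]
  split_ifs
  · exact hV.finite
  · exact hV.finite.union ((hlow.image _).subset Set.sdiff_subset)

theorem exists_isMinRank (hV : Invariant C y d m D B n)
    (h : (candidates y m D B).Nonempty) : ∃ f, IsMinRank (candidates y m D B) f := by
  have hD : D.Finite := (Set.finite_range C).subset fun f hf => by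
    obtain ⟨i, -, rfl⟩ := (hV.mem_D f).mp hf
    exact ⟨i, rfl⟩
  have hhigh : (highest B).Finite := hV.finite.subset fun b hb => hb.1
  have hfin : (candidates y m D B).Finite :=
    hD.union ((hhigh.image _).subset fun b hb => hb.1)
  obtain ⟨f, hf, hmin⟩ := Set.exists_min_image _ rk hfin h
  exact ⟨f, hf, hmin⟩

variable [CharZero K]

theorem mem_B' (hI : IsInput C y d m) (hV : Invariant C y d m D B n) {b : DiffPoly Y K}
    (hb : b ∈ B) : ∃ i j, j < n i ∧ ld b = (⟨y i, d i + j⟩ : Deriv Y) ∧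
      rk b = rk (δ^[j] (C i)) ∧ ∀ t, t ≠ i → Reduced b (C t) := by
  obtain ⟨i, j, hj, hrk, hred⟩ := hV.mem_B b hb
  exact ⟨i, j, hj, ld_eq_of_rk_eq (ld_δ_iterate hI.ranking (hI.ld_C i) j) hrk, hrk, hred⟩

theorem lt_and_rk (hI : IsInput C y d m) (hV : Invariant C y d m D B n)
    {b : DiffPoly Y K} (hb : b ∈ B) {i : Fin k} {j : ℕ}
    (h : ld b = (⟨y i, d i + j⟩ : Deriv Y)) :
    j < n i ∧ rk b = rk (δ^[j] (C i)) ∧ ∀ t, t ≠ i → Reduced b (C t) := by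
  obtain ⟨i', j', hj, hld, hrk, hred⟩ := hV.mem_B' hI hb
  rw [hld, WithBot.coe_inj, Deriv.mk.injEq] at h
  obtain rfl := hI.injective h.1
  obtain rfl : j' = j := by omega
  exact ⟨hj, hrk, hred⟩

theorem mem_highest (hI : IsInput C y d m) (hV : Invariant C y d m D B n) {b : DiffPoly Y K}
    (hb : b ∈ B) {i : Fin k} (h : ld b = (⟨y i, d i + (n i - 1)⟩ : Deriv Y)) :
    b ∈ highest B := by
  refine ⟨hb, fun c hc hlv => ?_⟩
  obtain ⟨t, j, hj, hld, -⟩ := hV.mem_B' hI hc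
  rw [lv_of_ld h, lv_of_ld hld, WithBot.coe_inj] at hlv
  obtain rfl := hI.injective hlv
  exact hV.rk_le_rk hI hc hb hld h (by omega)

theorem ld_of_mem_highest (hI : IsInput C y d m) (hV : Invariant C y d m D B n)
    {b : DiffPoly Y K} (hb : b ∈ highest B) :
    ∃ i, 0 < n i ∧ ld b = (⟨y i, d i + (n i - 1)⟩ : Deriv Y) := by
  obtain ⟨i, j, hj, hld, -⟩ := hV.mem_B' hI hb.1
  obtain ⟨c, hc, hcl⟩ := hV.exists_ld i (n i - 1) (by omega)
  have h1 := le_of_rk_le hcl hld (hb.2 c hc (by rw [lv_of_ld hcl, lv_of_ld hld]))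
  have h2 := hI.ranking.mk_le_mk.mp h1
  exact ⟨i, by omega, by rw [hld, show d i + j = d i + (n i - 1) by omega]⟩

theorem mem_lowest (hI : IsInput C y d m) (hV : Invariant C y d m D B n) {b : DiffPoly Y K}
    (hb : b ∈ B) {i : Fin k} (h : ld b = (⟨y i, d i⟩ : Deriv Y)) : b ∈ lowest B := by
  refine ⟨hb, fun c hc hlv => ?_⟩
  obtain ⟨t, j, hj, hld, -⟩ := hV.mem_B' hI hc
  rw [lv_of_ld h, lv_of_ld hld, WithBot.coe_inj] at hlv
  obtain rfl := hI.injective hlv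
  exact hV.rk_le_rk hI hb hc h hld (by omega)

theorem ld_of_mem_lowest (hI : IsInput C y d m) (hV : Invariant C y d m D B n)
    {b : DiffPoly Y K} (hb : b ∈ lowest B) :
    ∃ i, 0 < n i ∧ ld b = (⟨y i, d i⟩ : Deriv Y) := by
  obtain ⟨i, j, hj, hld, -⟩ := hV.mem_B' hI hb.1
  obtain ⟨c, hc, hcl⟩ := hV.exists_ld i 0 (by omega)
  have h1 := le_of_rk_le hld hcl (hb.2 c hc (by rw [lv_of_ld hcl, lv_of_ld hld]))
  have h2 := hI.ranking.mk_le_mk.mp h1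
  exact ⟨i, by omega, by rw [hld, show d i + j = d i by omega]⟩

/-- The leader bounds the order in its own indeterminate; reducedness with respect to `C t` bounds
the others by `d t`. -/
theorem ord_le_m (hI : IsInput C y d m) (hV : Invariant C y d m D B n) {b : DiffPoly Y K}
    (hb : b ∈ B) {t : Fin k} {e : ℕ} (h : (⟨y t, e⟩ : Deriv Y) ∈ b.vars) : e ≤ m t := by
  obtain ⟨i, j, hj, hld, hrk, hred⟩ := hV.mem_B' hI hb
  have hn := hV.n_le i
  have hd := hI.d_le i
  by_cases hti : t = i
  · subst hti
    have := hI.ranking.mk_le_mk.mp ((ld_eq_coe.mp hld).2 _ h)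
    omega
  · exact (hI.ord_le_of_reduced (hred t hti) h).trans (hI.d_le t)

/-- This sharper bound limits the derivatives of lowest elements to order `d t + 1`. -/
theorem ord_le_of_mem_lowest (hI : IsInput C y d m) (hV : Invariant C y d m D B n)
    {b : DiffPoly Y K} (hb : b ∈ lowest B) {t : Fin k} {e : ℕ}
    (h : (⟨y t, e⟩ : Deriv Y) ∈ b.vars) : e ≤ d t := by
  obtain ⟨i, hi, hld⟩ := hV.ld_of_mem_lowest hI hb
  obtain ⟨-, -, hred⟩ := hV.lt_and_rk hI (j := 0) hb.1 hld
  by_cases hti : t = i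
  · subst hti
    exact hI.ranking.mk_le_mk.mp ((ld_eq_coe.mp hld).2 _ h)
  · exact hI.ord_le_of_reduced (hred t hti) h

/-- A description of the element chosen in an iteration. -/
theorem of_mem_candidates (hI : IsInput C y d m) (hV : Invariant C y d m D B n)
    {f : DiffPoly Y K} (hf : f ∈ candidates y m D B) :
    ∃ i, n i ≤ m i - d i ∧ ld f = (⟨y i, d i + n i⟩ : Deriv Y) ∧
      rk f = rk (δ^[n i] (C i)) ∧
      IsChosen C y d D B n f i := by
  rcases hf with hf | ⟨⟨b, hb, rfl⟩, hbound⟩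
  · obtain ⟨i, hi, rfl⟩ := (hV.mem_D f).mp hf
    exact ⟨i, by omega, by rw [hi]; exact hI.ld_C i, by rw [hi]; rfl, Or.inl ⟨hi, rfl, hf⟩⟩
  · obtain ⟨i, hi, hld⟩ := hV.ld_of_mem_highest hI hb
    have hd := hI.d_le i
    have hld' : ld (δ b) = (⟨y i, d i + n i⟩ : Deriv Y) := by
      rw [ld_δ hI.ranking hld, Deriv.shift]
      simp only [show d i + (n i - 1) + 1 = d i + n i by omega]
    have hle := hbound i _ hld'
    refine ⟨i, by omega, hld', ?_, Or.inr ⟨hi, fun hD => ?_, b, hb.1, hld, rfl⟩⟩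
    · obtain ⟨l, hl⟩ : ∃ l, n i = l + 1 := ⟨n i - 1, by omega⟩
      rw [hl, Nat.add_sub_cancel] at hld
      rw [rk_δ hI.ranking hld, hl, Function.iterate_succ_apply',
        rk_δ hI.ranking (ld_δ_iterate hI.ranking (hI.ld_C i) l)]
    -- An element of `D` belongs to an empty row, whereas comparison of leaders puts `δ b` in the
    -- nonempty row `i`.
    · obtain ⟨t, ht, hCt⟩ := (hV.mem_D _).mp hD
      rw [hCt, hI.ld_C t, WithBot.coe_inj, Deriv.mk.injEq] at hld'
      obtain rfl := hI.injective hld'.1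
      omega

/-- A row that is begun but not full offers its next entry as a candidate. This gives both the
minimality argument and fullness at the exit. -/
theorem δ_mem_candidates (hI : IsInput C y d m) (hV : Invariant C y d m D B n) {t : Fin k}
    (hn : 0 < n t) (hle : d t + n t ≤ m t) : ∃ g ∈ candidates y m D B,
      ld g = (⟨y t, d t + n t⟩ : Deriv Y) := by
  obtain ⟨b, hb, hld⟩ := hV.exists_ld t (n t - 1) (by omega)
  have hld' : ld (δ b) = (⟨y t, d t + n t⟩ : Deriv Y) := by
    rw [ld_δ hI.ranking hld, Deriv.shift]
    simp only [show d t + (n t - 1) + 1 = d t + n t by omega]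
  refine ⟨δ b, Or.inr ⟨⟨b, hV.mem_highest hI hb hld, rfl⟩, fun i e he => ?_⟩, hld'⟩
  rw [hld', WithBot.coe_inj, Deriv.mk.injEq] at he
  obtain rfl := hI.injective he.1
  omega

/-- When an element of leader `u` is chosen, all elements of lower leader have been computed. -/
theorem lt_of_lt (hI : IsInput C y d m) (hV : Invariant C y d m D B n) {f : DiffPoly Y K}
    {u : Deriv Y} (hf : IsMinRank (candidates y m D B) f) (hu : ld f = u) {t : Fin k} {e : ℕ}
    (hlt : (⟨y t, d t + e⟩ : Deriv Y) < u) (he : d t + e ≤ m t) : e < n t := by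
  by_contra! hle
  rcases Nat.eq_zero_or_pos (n t) with h0 | hpos
  · have h1 := le_of_rk_le hu (hI.ld_C t) (hf.2 _ (Or.inl ((hV.mem_D _).mpr ⟨t, h0, rfl⟩)))
    exact (h1.trans (hI.ranking.mk_le_mk.mpr (by omega))).not_gt hlt
  · obtain ⟨g, hg, hgl⟩ := hV.δ_mem_candidates hI hpos (by omega)
    have h1 := le_of_rk_le hu hgl (hf.2 g hg)
    exact (h1.trans (hI.ranking.mk_le_mk.mpr (by omega))).not_gt hlt

end Invariant

end invariant

/-! ### A single reduction -/

section iteration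

variable {Y K : Type*} [Field K] [LinearOrder (Deriv Y)] [Differential K]

theorem subset_reducers (D B : Set (DiffPoly Y K)) (f : DiffPoly Y K) : B ⊆ reducers D B f := by
  rw [reducers]
  split_ifs
  · exact subset_rfl
  · exact Set.subset_union_left

theorem mem_reducers {D B : Set (DiffPoly Y K)} {f p : DiffPoly Y K} (h : p ∈ reducers D B f) :
    p ∈ B ∨ (f ∉ D ∧ p ≠ f ∧ ∃ b ∈ lowest B, p = δ b) := by
  rw [reducers] at h
  split_ifs at h with hD
  · exact Or.inl h
  · rcases h with h | ⟨⟨b, hb, rfl⟩, hne⟩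
    · exact Or.inl h
    · exact Or.inr ⟨hD, hne, b, hb, rfl⟩

theorem δ_mem_reducers {D B : Set (DiffPoly Y K)} {f b : DiffPoly Y K} (hD : f ∉ D)
    (hb : b ∈ lowest B) (hne : δ b ≠ f) : δ b ∈ reducers D B f := by
  rw [reducers, if_neg hD]
  exact Or.inr ⟨⟨b, hb, rfl⟩, hne⟩

variable {k : ℕ} {C : Fin k → DiffPoly Y K} {y : Fin k → Y} {d m : Fin k → ℕ}
  {D B : Set (DiffPoly Y K)} {n : Fin k → ℕ}

namespace Invariant

theorem reducers_subset_diffIdeal (hV : Invariant C y d m D B n) (f : DiffPoly Y K) :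
    reducers D B f ⊆ diffIdeal (lowest B) := by
  intro p hp
  rcases mem_reducers hp with hpB | ⟨-, -, b, hb, rfl⟩
  · exact hV.subset_lowest hpB
  · exact δ_mem_diffIdeal (DiffAlg.subset_diffIdeal _ hb)

theorem diffIdeal_lowest_le (hV : Invariant C y d m D B n) :
    diffIdeal (lowest B) ≤ diffIdeal (Set.range C) :=
  diffIdeal_le_of_subset fun _ hb => hV.subset_diffIdeal hb.1

variable [CharZero K]

/-- None of the reducers has the leader of the chosen element. -/
theorem ld_ne_of_mem_reducers (hI : IsInput C y d m) (hV : Invariant C y d m D B n)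
    {f p : DiffPoly Y K} {i : Fin k} (hfl : ld f = (⟨y i, d i + n i⟩ : Deriv Y))
    (hf : IsChosen C y d D B n f i)
    (hp : p ∈ reducers D B f) : ld p ≠ (⟨y i, d i + n i⟩ : Deriv Y) := by
  intro hpl
  rcases mem_reducers hp with hpB | ⟨hD, hne, b, hb, rfl⟩
  · exact (hV.lt_and_rk hI hpB hpl).1.false
  · obtain ⟨t, ht, hbl⟩ := hV.ld_of_mem_lowest hI hb
    rw [ld_δ hI.ranking hbl, WithBot.coe_inj, Deriv.shift, Deriv.mk.injEq] at hpl
    simp only at hpl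
    obtain rfl := hI.injective hpl.1
    -- If the derivative of a lowest element had this leader, that element would also be the last of
    -- its row. Its derivative would be `f` itself, which is removed from the reducers.
    rcases hf with ⟨-, -, hD'⟩ | ⟨-, -, c, hc, hcl, rfl⟩
    · exact hD hD'
    · rw [show d t + (n t - 1) = d t by omega] at hcl
      exact hne (by rw [hV.injOn hb.1 hc (hbl.trans hcl.symm)])

/-- A derivative has as initial the separant of the original element, so the added reducers bring no
new multipliers. -/
theorem initial_reducers_subset (hI : IsInput C y d m) (hV : Invariant C y d m D B n)
    (f : DiffPoly Y K) : initial '' reducers D B f ⊆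
      powers (initSep (Set.range C)) + (diffIdeal (Set.range C) : Set (DiffPoly Y K)) := by
  rintro _ ⟨p, hp, rfl⟩
  rcases mem_reducers hp with hpB | ⟨-, -, b, hb, rfl⟩
  · exact hV.initSep_subset (initial_mem_initSep hpB)
  · obtain ⟨t, ht, hbl⟩ := hV.ld_of_mem_lowest hI hb
    rw [initial_δ hI.ranking hbl]
    exact hV.initSep_subset (separant_mem_initSep hb.1)

theorem initial_separant_mem_of_chosen (hI : IsInput C y d m) (hV : Invariant C y d m D B n)
    {f : DiffPoly Y K} {i : Fin k}
    (hf : IsChosen C y d D B n f i) :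
    initial f ∈ powers (initSep (Set.range C)) +
        (diffIdeal (Set.range C) : Set (DiffPoly Y K)) ∧
      separant f ∈ powers (initSep (Set.range C)) +
        (diffIdeal (Set.range C) : Set (DiffPoly Y K)) ∧
      f ∈ diffIdeal (Set.range C) := by
  rcases hf with ⟨-, rfl, -⟩ | ⟨-, -, b, hb, hbl, rfl⟩
  · exact ⟨powers_subset_powers_add _ _ (subset_powers _ (initial_mem_initSep ⟨i, rfl⟩)),
      powers_subset_powers_add _ _ (subset_powers _ (separant_mem_initSep ⟨i, rfl⟩)),
      DiffAlg.subset_diffIdeal _ ⟨i, rfl⟩⟩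
  · rw [initial_δ hI.ranking hbl, separant_δ hI.ranking hbl]
    exact ⟨hV.initSep_subset (separant_mem_initSep hb),
      hV.initSep_subset (separant_mem_initSep hb), δ_mem_diffIdeal (hV.subset_diffIdeal hb)⟩

/-- If the rank drops in a reduction, the system is inconsistent. -/
theorem saturation_eq_univ (hI : IsInput C y d m) (hV : Invariant C y d m D B n)
    {f g : DiffPoly Y K} (hf : IsMinRank (candidates y m D B) f)
    (hrem : AlgRem (reducers D B f) f g) (hrk : rk g ≠ rk f) :
    saturation (diffIdeal (Set.range C)) (initSep (Set.range C)) = Set.univ := by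
  obtain ⟨i, -, hfl, -, hcase⟩ := hV.of_mem_candidates hI hf.1
  obtain ⟨hle, -, hdeg, a, ha, -, hcoeff, -⟩ := exists_mul_sub_mem_of_pseudoDivisions
    (fun p hp => hV.ld_ne_of_mem_reducers hI hfl hcase hp) (ld_eq_coe.mp hfl).2 hrem.1
  set u : Deriv Y := ⟨y i, d i + n i⟩
  -- With equal degree in `u`, which bounds all derivatives in `g`, the ranks would agree.
  have hlt : g.degreeOf u < f.degreeOf u := by
    refine lt_of_le_of_ne hdeg fun he => hrk ?_
    rw [rk_of_ld hfl, rk_eq_coe]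
    refine ⟨ld_eq_coe.mpr ⟨?_, hle⟩, he⟩
    rw [mem_vars_iff_degreeOf_ne_zero, he]
    exact (degreeOf_pos_of_ld hfl).ne'
  have h1 := hcoeff (f.degreeOf u)
  rw [coeffIn_eq_zero hlt, sub_zero, ← initial_of_ld hfl] at h1
  refine saturation_eq_univ_of_mem (a := a * initial f) (mul_mem_powers_add
    (powers_subset_powers_add_of_subset (hV.initial_reducers_subset hI f) ha)
    (hV.initial_separant_mem_of_chosen hI hcase).1) ?_
  exact hV.diffIdeal_lowest_le (Ideal.span_le.mpr (hV.reducers_subset_diffIdeal f) h1)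

/-- Possible orders in `y t` of the result of a reduction. -/
theorem ord_le_of_algRem (hI : IsInput C y d m) (hV : Invariant C y d m D B n)
    {f g : DiffPoly Y K} {i : Fin k}
    (hf : IsChosen C y d D B n f i)
    (hvars : ∀ v ∈ g.vars, v ∈ f.vars ∨ ∃ p ∈ reducers D B f, v ∈ p.vars)
    {t : Fin k} (hti : t ≠ i) {e : ℕ} (h : (⟨y t, e⟩ : Deriv Y) ∈ g.vars) :
    e ≤ m t ∨ (f ∉ D ∧ e ≤ d t + 1) := by
  have hδ : ∀ b : DiffPoly Y K, (∀ e, (⟨y t, e⟩ : Deriv Y) ∈ b.vars → e ≤ d t) →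
      (⟨y t, e⟩ : Deriv Y) ∈ (δ b).vars → e ≤ d t + 1 := by
    intro b hb hmem
    rcases mem_vars_δ hmem with h | ⟨⟨v, l⟩, hw, heq⟩
    · exact (hb e h).trans (Nat.le_succ _)
    · rw [Deriv.shift, Deriv.mk.injEq] at heq
      obtain ⟨rfl, rfl⟩ := heq
      exact Nat.succ_le_succ (hb l hw)
  rcases hvars _ h with hv | ⟨p, hp, hv⟩
  · rcases hf with ⟨-, rfl, -⟩ | ⟨-, hD, b, hb, hbl, rfl⟩
    · exact Or.inl (hI.ord_le i t e hv)
    · obtain ⟨-, -, hred⟩ := hV.lt_and_rk hI hb hbl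
      exact Or.inr ⟨hD, hδ b (fun e he => hI.ord_le_of_reduced (hred t hti) he) hv⟩
  · rcases mem_reducers hp with hpB | ⟨hD, -, b, hb, rfl⟩
    · exact Or.inl (hV.ord_le_m hI hpB hv)
    · exact Or.inr ⟨hD, hδ b (fun e he => hV.ord_le_of_mem_lowest hI hb he) hv⟩

/-- The rank is that of a proper derivative. Being algebraically reduced with respect to such an
element therefore means not containing its leader. -/
theorem degreeOf_eq_one (hI : IsInput C y d m) (hV : Invariant C y d m D B n)
    {b : DiffPoly Y K} (hb : b ∈ B) {t : Fin k} {j : ℕ} (hj : 0 < j)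
    (hld : ld b = (⟨y t, d t + j⟩ : Deriv Y)) : b.degreeOf ⟨y t, d t + j⟩ = 1 := by
  obtain ⟨l, rfl⟩ : ∃ l, j = l + 1 := ⟨j - 1, by omega⟩
  obtain ⟨-, hrk, -⟩ := hV.lt_and_rk hI hb hld
  rw [Function.iterate_succ_apply',
    rk_δ hI.ranking (ld_δ_iterate hI.ranking (hI.ld_C t) l)] at hrk
  exact (rk_eq_coe.mp hrk).2

/-- Any derivative of `y t` in `g` lies below the leader of `f`, so the entries of row `t` up to it,
within the bound `m t`, are available as reducers. The first entry has the rank of `C t` and gives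
algebraic reducedness; later ones are linear in their leaders and exclude proper derivatives. -/
theorem reduced_of_algRem (hI : IsInput C y d m) (hV : Invariant C y d m D B n)
    {f g : DiffPoly Y K} {i : Fin k} (hmin : IsMinRank (candidates y m D B) f)
    (hfl : ld f = (⟨y i, d i + n i⟩ : Deriv Y))
    (hf : IsChosen C y d D B n f i)
    (hle : ∀ v ∈ g.vars, v ≤ ⟨y i, d i + n i⟩)
    (hvars : ∀ v ∈ g.vars, v ∈ f.vars ∨ ∃ p ∈ reducers D B f, v ∈ p.vars)
    (hred : ∀ p ∈ reducers D B f, AlgReduced g p) {t : Fin k} (hti : t ≠ i) :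
    Reduced g (C t) := by
  have hlt : ∀ e, (⟨y t, e⟩ : Deriv Y) ∈ g.vars →
      (⟨y t, e⟩ : Deriv Y) < ⟨y i, d i + n i⟩ := by
    intro e he
    refine lt_of_le_of_ne (hle _ he) fun h => ?_
    rw [Deriv.mk.injEq] at h
    exact hti (hI.injective h.1)
  constructor
  · rintro _ hu j hj hmem
    rw [hI.ld_C t, WithBot.coe_inj] at hu
    subst hu
    rw [Deriv.shift] at hmem
    simp only at hmem
    have hlt' := hlt _ hmem
    have key : ∀ p ∈ reducers D B f, ld p = (⟨y t, d t + j⟩ : Deriv Y) →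
        p.degreeOf ⟨y t, d t + j⟩ = 1 → False := by
      intro p hp hpl hdeg
      have := hred p hp _ hpl
      rw [mem_vars_iff_degreeOf_ne_zero] at hmem
      omega
    rcases hV.ord_le_of_algRem hI hf hvars hti hmem with hm | ⟨hD, hd⟩
    · obtain ⟨b, hb, hbl⟩ := hV.exists_ld t j (hV.lt_of_lt hI hmin hfl hlt' hm)
      exact key b (subset_reducers D B f hb) hbl (hV.degreeOf_eq_one hI hb hj hbl)
    -- The order `d t + 1` may exceed `m t`, so row `t` need not have an entry there; the derivative
    -- of its lowest element takes that role.
    · obtain rfl : j = 1 := by omega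
      have h0 : 0 < n t := hV.lt_of_lt hI hmin hfl
        ((hI.ranking.mk_le_mk.mpr (by omega)).trans_lt hlt') (hI.d_le t)
      obtain ⟨b, hb, hbl⟩ := hV.exists_ld t 0 h0
      have hδl := ld_δ hI.ranking hbl
      refine key (δ b) (δ_mem_reducers hD (hV.mem_lowest hI hb hbl) ?_) hδl
        (degreeOf_δ hI.ranking hbl)
      rintro rfl
      rw [hδl, WithBot.coe_inj, Deriv.shift, Deriv.mk.injEq] at hfl
      exact hti (hI.injective hfl.1)
  · rintro _ hu
    rw [hI.ld_C t, WithBot.coe_inj] at hu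
    subst hu
    by_cases hmem : (⟨y t, d t⟩ : Deriv Y) ∈ g.vars
    · have h0 : 0 < n t := hV.lt_of_lt hI hmin hfl (hlt _ hmem) (hI.d_le t)
      obtain ⟨b, hb, hbl⟩ := hV.exists_ld t 0 h0
      obtain ⟨-, hrk, -⟩ := hV.lt_and_rk hI hb hbl
      rw [← degreeOf_eq_of_rk_eq (hI.ld_C t) hrk]
      exact hred b (subset_reducers D B f hb) _ hbl
    · have h0 : g.degreeOf ⟨y t, d t⟩ = 0 := by
        simpa [mem_vars_iff_degreeOf_ne_zero] using hmem
      rw [h0]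
      exact degreeOf_pos_of_ld (hI.ld_C t)

end Invariant

end iteration

/-! ### Preservation of the invariant and counting of iterations -/

section correctness

variable {Y K : Type*} [Field K] [LinearOrder (Deriv Y)] [Differential K] {k : ℕ}
  {C : Fin k → DiffPoly Y K} {y : Fin k → Y} {d m : Fin k → ℕ} {D B : Set (DiffPoly Y K)}
  {n : Fin k → ℕ}

/-- The invariant of a state that is reached after `N` iterations. -/
def StateInvariant (C : Fin k → DiffPoly Y K) (y : Fin k → Y) (d m : Fin k → ℕ) (N : ℕ) :
    State Y K → Prop
  | .loop D B => ∃ n, Invariant C y d m D B n ∧ ∑ i, n i = N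
  | .halted out => N ≤ ∑ i, (m i - d i + 1) ∧ out = {1} ∧
      saturation (diffIdeal (Set.range C)) (initSep (Set.range C)) = Set.univ

theorem StateInvariant.le {N : ℕ} {s : State Y K} (h : StateInvariant C y d m N s) :
    N ≤ ∑ i, (m i - d i + 1) := by
  cases s with
  | loop D B =>
    obtain ⟨n, hV, rfl⟩ := h
    exact Finset.sum_le_sum fun t _ => hV.n_le t
  | halted out => exact h.1

theorem stateInvariant_init (C : Fin k → DiffPoly Y K) (y : Fin k → Y) (d m : Fin k → ℕ) :
    StateInvariant C y d m 0 (.loop (Set.range C) ∅) :=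
  ⟨0, invariant_init C y d m, by simp⟩

namespace Invariant

/-- The orders in the non-leading indeterminates grow by at most one in a differentiation, and do
not grow in the other iterations. -/
theorem ord_le_of_algRem_of_notMem_range (hV : Invariant C y d m D B n)
    {f g : DiffPoly Y K} {i : Fin k} (hf : IsChosen C y d D B n f i)
    (hvars : ∀ v ∈ g.vars, v ∈ f.vars ∨ ∃ p ∈ reducers D B f, v ∈ p.vars)
    {v : Y} (hv : v ∉ Set.range y) {e : ℕ} (h : (⟨v, e⟩ : Deriv Y) ∈ g.vars) :
    e ≤ maxOrd v (Set.range C) + ∑ t, ((n + Pi.single i 1 : Fin k → ℕ) t - 1) := by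
  have hδ : ∀ b ∈ B, (⟨v, e⟩ : Deriv Y) ∈ (δ b).vars →
      e ≤ maxOrd v (Set.range C) + ∑ t, (n t - 1) + 1 := by
    intro b hb hmem
    rcases mem_vars_δ hmem with h | ⟨⟨w, l⟩, hw, heq⟩
    · exact (hV.ord_le b hb v hv e h).trans (Nat.le_succ _)
    · rw [Deriv.shift, Deriv.mk.injEq] at heq
      obtain ⟨rfl, rfl⟩ := heq
      exact Nat.succ_le_succ (hV.ord_le b hb v hv l hw)
  have hmono : ∑ t, (n t - 1) ≤ ∑ t, ((n + Pi.single i 1 : Fin k → ℕ) t - 1) :=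
    Finset.sum_le_sum fun t _ => Nat.sub_le_sub_right (Nat.le_add_right _ _) 1
  -- The truncated `n t - 1` counts the differentiations in row `t`: the first entry costs none, so
  -- the sum grows only if row `i` is already begun.
  have hsucc : 0 < n i → ∑ t, ((n + Pi.single i 1 : Fin k → ℕ) t - 1) = ∑ t, (n t - 1) + 1 := by
    intro hi
    have : ∀ t, (n + Pi.single i 1 : Fin k → ℕ) t - 1 = (n t - 1) + (Pi.single i 1 : Fin k → ℕ) t := by
      intro t
      rw [Pi.add_apply]
      by_cases hti : t = i
      · subst hti
        rw [Pi.single_eq_same]; omega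
      · rw [Pi.single_eq_of_ne hti]; omega
    simp_rw [this, Finset.sum_add_distrib]
    simp
  rcases hvars _ h with hmem | ⟨p, hp, hmem⟩
  · rcases hf with ⟨-, rfl, -⟩ | ⟨hi, -, b, hb, -, rfl⟩
    · exact (ord_le_maxOrd (Set.finite_range C) ⟨i, rfl⟩ hmem).trans (Nat.le_add_right _ _)
    · rw [hsucc hi]
      exact hδ b hb hmem
  · rcases mem_reducers hp with hpB | ⟨hD, -, b, hb, rfl⟩
    · exact (hV.ord_le p hpB v hv e hmem).trans (Nat.add_le_add_left hmono _)
    · rcases hf with ⟨-, -, hD'⟩ | ⟨hi, -⟩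
      · exact absurd hD' hD
      · rw [hsucc hi]
        exact hδ b hb.1 hmem

variable [CharZero K]

/-- A new entry in a nonempty row has higher order than the first one, so lowest elements stay
lowest. -/
theorem lowest_subset_insert (hI : IsInput C y d m) (hV : Invariant C y d m D B n)
    {g : DiffPoly Y K} {i : Fin k} (hgl : ld g = (⟨y i, d i + n i⟩ : Deriv Y)) :
    lowest B ⊆ lowest (B ∪ {g}) := by
  intro b hb
  refine ⟨Or.inl hb.1, ?_⟩
  rintro c (hc | rfl) hlv
  · exact hb.2 c hc hlv
  · obtain ⟨t, ht, hbl⟩ := hV.ld_of_mem_lowest hI hb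
    rw [lv_of_ld hgl, lv_of_ld hbl, WithBot.coe_inj] at hlv
    obtain rfl := hI.injective hlv
    refine rk_le_of_lt hbl hgl (lt_of_not_ge fun hle => ?_)
    have := hI.ranking.mk_le_mk.mp hle
    omega

/-- The invariant is preserved by an iteration that does not stop the algorithm. -/
theorem update (hI : IsInput C y d m) (hV : Invariant C y d m D B n)
    {f g : DiffPoly Y K} (hmin : IsMinRank (candidates y m D B) f)
    (hrem : AlgRem (reducers D B f) f g) (hrk : rk g = rk f) :
    ∃ i, n i ≤ m i - d i ∧ Invariant C y d m (D \ {f}) (B ∪ {g}) (n + Pi.single i 1) := by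
  obtain ⟨i, hni, hfl, hfrk, hcase⟩ := hV.of_mem_candidates hI hmin.1
  obtain ⟨hle, hvars, hdeg, a, ha, hfg, hcoeff, hpd⟩ := exists_mul_sub_mem_of_pseudoDivisions
    (fun p hp => hV.ld_ne_of_mem_reducers hI hfl hcase hp) (ld_eq_coe.mp hfl).2 hrem.1
  have hgl := ld_eq_of_rk_eq hfl hrk
  have hgdeg := degreeOf_eq_of_rk_eq hfl hrk
  set u : Deriv Y := ⟨y i, d i + n i⟩ with hu
  have hini := hcoeff (f.degreeOf u)
  rw [← initial_of_ld hfl, ← hgdeg, ← initial_of_ld hgl] at hini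
  rw [← separant_of_ld hfl, ← separant_of_ld hgl] at hpd
  have hlow := hV.lowest_subset_insert hI hgl
  have hspan : Ideal.span (reducers D B f) ≤ diffIdeal (lowest B) :=
    Ideal.span_le.mpr (hV.reducers_subset_diffIdeal f)
  have hspanC : Ideal.span (reducers D B f) ≤ diffIdeal (Set.range C) :=
    hspan.trans hV.diffIdeal_lowest_le
  have haC := powers_subset_powers_add_of_subset (hV.initial_reducers_subset hI f) ha
  obtain ⟨hfi, hfs, hfC⟩ := hV.initial_separant_mem_of_chosen hI hcase
  have hmem_of : ∀ I : Ideal (DiffPoly Y K), Ideal.span (reducers D B f) ≤ I → f ∈ I → g ∈ I := by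
    intro I hSI hfI
    have := I.sub_mem (I.mul_mem_left a hfI) (hSI hfg)
    simpa using this
  have hBg : B ⊆ B ∪ {g} := Set.subset_union_left
  have hn' : ∀ t, t ≠ i → (n + Pi.single i 1 : Fin k → ℕ) t = n t := fun t ht => by
    rw [Pi.add_apply, Pi.single_eq_of_ne ht, add_zero]
  have hni' : (n + Pi.single i 1 : Fin k → ℕ) i = n i + 1 := by rw [Pi.add_apply, Pi.single_eq_same]
  have hnle : ∀ t, n t ≤ (n + Pi.single i 1 : Fin k → ℕ) t := fun t => Nat.le_add_right _ _
  have hld_ne : ∀ b ∈ B, ld b ≠ ld g := by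
    intro b hb h
    rw [hgl] at h
    exact (hV.lt_and_rk hI hb h).1.false
  refine ⟨i, hni, ?_⟩
  constructor
  case mem_D =>
    intro c
    constructor
    · rintro ⟨hc, hne⟩
      obtain ⟨t, ht, rfl⟩ := (hV.mem_D c).mp hc
      refine ⟨t, ?_, rfl⟩
      rw [hn' t, ht]
      rintro rfl
      rcases hcase with ⟨-, rfl, -⟩ | ⟨h0, -⟩
      · exact hne rfl
      · omega
    · rintro ⟨t, ht, rfl⟩
      have hti : t ≠ i := by
        rintro rfl
        omega
      rw [hn' t hti] at ht
      refine ⟨(hV.mem_D _).mpr ⟨t, ht, rfl⟩, fun h => hti ?_⟩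
      rw [← show C t = f from h, hI.ld_C t, WithBot.coe_inj, hu, Deriv.mk.injEq] at hfl
      exact hI.injective hfl.1
  case n_le =>
    intro t
    by_cases hti : t = i
    · subst hti
      omega
    · rw [hn' t hti]
      exact hV.n_le t
  case finite => exact hV.finite.union (Set.finite_singleton g)
  case exists_ld =>
    intro t j hj
    by_cases hjn : j < n t
    · obtain ⟨b, hb, hbl⟩ := hV.exists_ld t j hjn
      exact ⟨b, hBg hb, hbl⟩
    · have hti : t = i := by
        by_contra hti
        rw [hn' t hti] at hj
        exact hjn hj
      subst hti
      obtain rfl : j = n t := by omega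
      exact ⟨g, Or.inr rfl, hgl⟩
  case mem_B =>
    rintro b (hb | rfl)
    · obtain ⟨t, j, hj, h⟩ := hV.mem_B b hb
      exact ⟨t, j, hj.trans_le (hnle t), h⟩
    · exact ⟨i, n i, by omega, hrk.trans hfrk, fun t hti =>
        hV.reduced_of_algRem hI hmin hfl hcase hle hvars hrem.2 hti⟩
  case injOn =>
    rintro b (hb | rfl) c (hc | rfl) h
    · exact hV.injOn hb hc h
    · exact absurd h (hld_ne b hb)
    · exact absurd h.symm (hld_ne c hc)
    · rfl
  case ord_le =>
    rintro b (hb | rfl) v hv e he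
    · refine (hV.ord_le b hb v hv e he).trans (Nat.add_le_add_left ?_ _)
      exact Finset.sum_le_sum fun t _ => Nat.sub_le_sub_right (hnle t) 1
    · exact hV.ord_le_of_algRem_of_notMem_range hcase hvars hv he
  case subset_lowest =>
    rintro b (hb | rfl)
    · exact diffIdeal_mono hlow (hV.subset_lowest hb)
    -- A reduced input opens its row and is itself lowest. In the other case `g` is congruent to `a
    -- δ c`, with `c` already in the ideal of the lowest elements.
    · rcases hcase with ⟨h0, -, -⟩ | ⟨h0, -, c, hc, -, rfl⟩
      · refine DiffAlg.subset_diffIdeal _ ⟨Or.inr rfl, ?_⟩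
        rintro c (hc | rfl) hlv
        · obtain ⟨t, j, hj, hcl, -⟩ := hV.mem_B' hI hc
          rw [lv_of_ld hgl, lv_of_ld hcl, WithBot.coe_inj] at hlv
          obtain rfl := hI.injective hlv
          omega
        · exact le_rfl
      · exact diffIdeal_mono hlow
          (hmem_of _ hspan (δ_mem_diffIdeal (hV.subset_lowest hc)))
  case subset_diffIdeal =>
    rintro b (hb | rfl)
    · exact hV.subset_diffIdeal hb
    · exact hmem_of _ hspanC hfC
  case initSep_subset =>
    rintro _ (⟨b, hb | rfl, rfl⟩ | ⟨b, hb | rfl, rfl⟩)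
    · exact hV.initSep_subset (initial_mem_initSep hb)
    · exact mem_powers_add_of_sub_mem (mul_mem_powers_add haC hfi) (hspanC hini)
    · exact hV.initSep_subset (separant_mem_initSep hb)
    · exact mem_powers_add_of_sub_mem (mul_mem_powers_add haC hfs) (hspanC hpd)
  case mem_saturation =>
    intro t ht
    have hHB : initSep B ⊆ initSep (B ∪ {g}) := initSep_mono hBg
    have hIB : (diffIdeal B : Set (DiffPoly Y K)) ⊆ diffIdeal (B ∪ {g}) := diffIdeal_mono hBg
    by_cases hnt : 0 < n t
    · obtain ⟨h1, h2, h3⟩ := hV.mem_saturation t hnt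
      have hadd := Set.add_subset_add (powers_mono hHB) hIB
      exact ⟨saturation_mono hIB hHB h1, saturation_mono hadd hHB h2,
        saturation_mono hadd hHB h3⟩
    · obtain rfl : t = i := by
        by_contra hti
        rw [hn' t hti] at ht
        exact hnt ht
      -- Only the first entry of a row needs an argument. There the reducers are `B` alone, so the
      -- multiplier `a` lies in `H_B^∞` and the congruences hold modulo `[B]`.
      rcases hcase with ⟨-, rfl, hD⟩ | ⟨h0, -⟩
      · have hgB : g ∈ B ∪ {g} := Or.inr rfl
        have hSB : reducers D B (C t) = B := if_pos hD
        rw [hSB] at ha hfg hini hpd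
        have hspanB : Ideal.span B ≤ diffIdeal (B ∪ {g}) :=
          Ideal.span_le.mpr (hBg.trans (DiffAlg.subset_diffIdeal _))
        have haB : a ∈ powers (initSep (B ∪ {g})) :=
          powers_mono ((Set.subset_union_left).trans hHB) ha
        refine ⟨⟨a, haB, ?_⟩, ⟨a, haB, mem_powers_add.mpr ⟨_, ?_, hspanB hini⟩⟩,
          ⟨a, haB, mem_powers_add.mpr ⟨_, ?_, hspanB hpd⟩⟩⟩
        · have := add_mem (hspanB hfg) (DiffAlg.subset_diffIdeal _ hgB)
          simpa using this
        · exact subset_powers _ (initial_mem_initSep hgB)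
        · exact subset_powers _ (separant_mem_initSep hgB)
      · exact absurd h0 hnt

end Invariant

variable [CharZero K]

theorem StateInvariant.step (hI : IsInput C y d m) {N : ℕ} {s s' : State Y K}
    (h : StateInvariant C y d m N s) (hs : Iteration y m s s') :
    StateInvariant C y d m (N + 1) s' := by
  cases hs with
  | update D B f g hmin hrem hrk =>
    obtain ⟨n, hV, rfl⟩ := h
    obtain ⟨i, -, hV'⟩ := hV.update hI hmin hrem hrk
    refine ⟨_, hV', ?_⟩
    simp [Finset.sum_add_distrib]
  | abort D B f g hmin hrem hrk =>
    obtain ⟨n, hV, rfl⟩ := h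
    refine ⟨?_, rfl, hV.saturation_eq_univ hI hmin hrem hrk⟩
    -- The row of the chosen element is not full; the strict inequality there pays for the aborting
    -- iteration.
    obtain ⟨i, hi, -⟩ := hV.of_mem_candidates hI hmin.1
    exact Finset.sum_lt_sum (fun t _ => hV.n_le t) ⟨i, Finset.mem_univ i, by omega⟩

theorem exists_stateInvariant (hI : IsInput C y d m) {s : State Y K}
    (h : Reachable y m (Set.range C) s) : ∃ N, StateInvariant C y d m N s := by
  induction h with
  | refl => exact ⟨0, stateInvariant_init C y d m⟩
  | tail _ hstep ih =>
    obtain ⟨N, hN⟩ := ih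
    exact ⟨N + 1, hN.step hI hstep⟩

theorem Invariant.n_eq_of_candidates_eq_empty (hI : IsInput C y d m)
    (hV : Invariant C y d m D B n) (h : candidates y m D B = ∅) (i : Fin k) :
    n i = m i - d i + 1 := by
  have hd := hI.d_le i
  have hn := hV.n_le i
  have h0 : 0 < n i := by
    by_contra h0
    have : C i ∈ candidates y m D B :=
      Or.inl ((hV.mem_D _).mpr ⟨i, by omega, rfl⟩)
    rw [h] at this
    exact this
  by_contra hne
  obtain ⟨g, hg, -⟩ := hV.δ_mem_candidates hI h0 (by omega)
  rw [h] at hg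
  exact hg

end correctness

end

end DiffAlg

/-! ### The proposition -/

open DiffAlg in
theorem mainTheorem4 {Y K : Type*} [Finite Y] [Field K] [CharZero K] [Differential K]
    [LinearOrder (Deriv Y)] (hR : IsRanking Y)
    {k : ℕ} (C : Fin k → DiffPoly Y K) (y : Fin k → Y) (d m : Fin k → ℕ)
    (hCinj : Function.Injective C)
    (hC : WeakDTriangular (Set.range C))
    (hld : ∀ i, ld (C i) = (⟨y i, d i⟩ : Deriv Y))
    (hm : ∀ i, maxOrd (y i) (Set.range C) ≤ m i) :
    -- termination: the loop runs at most `∑ (m_i - d_i + 1)` times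
    (∀ (N : ℕ) (s : ℕ → State Y K), s 0 = .loop (Set.range C) ∅ →
      (∀ j < N, Iteration y m (s j) (s (j + 1))) → N ≤ ∑ i, (m i - d i + 1)) ∧
    -- termination: every call of `algrem` terminates
    (∀ D B f, Reachable y m (Set.range C) (.loop D B) → IsMinRank (candidates y m D B) f →
      AlgRemTerminates (reducers D B f) f) ∧
    -- the algorithm never gets stuck without an output
    (∀ s, Reachable y m (Set.range C) s →
      (∃ out, Returns y m s out) ∨ ∃ s', Iteration y m s s') ∧
    -- correctness of every output
    (∀ s out, Reachable y m (Set.range C) s → Returns y m s out →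
      (∃ B : Fin k → ℕ → DiffPoly Y K,
        out = {b | ∃ i j, j ≤ m i - d i ∧ b = B i j} ∧
        Triangular out ∧
        (∀ i j, j ≤ m i - d i →
          rk (B i j) = rk (δ^[j] (C i)) ∧ ∀ t, t ≠ i → Reduced (B i j) (C t)) ∧
        (∀ i, maxOrd (y i) out ≤ m i) ∧
        (∀ v, v ∉ Set.range y →
          maxOrd v out ≤ maxOrd v (Set.range C) + ∑ i, (m i - d i)) ∧
        out ⊆ diffIdeal (lowest out) ∧
        diffIdeal (lowest out) ≤ diffIdeal (Set.range C) ∧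
        (diffIdeal (Set.range C) : Set (DiffPoly Y K)) ⊆
          saturation (diffIdeal out) (initSep out) ∧
        initSep out ⊆ powers (initSep (Set.range C)) + (diffIdeal (Set.range C) : Set _) ∧
        initSep (Set.range C) ⊆
          saturation (powers (initSep out) + (diffIdeal out : Set _)) (initSep out)) ∨
      (out = {1} ∧
        saturation (diffIdeal (Set.range C)) (initSep (Set.range C)) = Set.univ)) := by
  have hI : IsInput C y d m :=
    { ranking := hR
      ld_C := hld
      injective := fun i j hij => hCinj (hC.2 ⟨i, rfl⟩ ⟨j, rfl⟩ (by
        rw [lv_of_ld (hld i), lv_of_ld (hld j)]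
        exact congrArg _ hij))
      ord_le := fun i t e he =>
        (ord_le_maxOrd (Set.finite_range C) ⟨i, rfl⟩ he).trans (hm t) }
  refine ⟨?_, ?_, ?_, ?_⟩
  · intro N s h0 hs
    have key : ∀ j ≤ N, StateInvariant C y d m j (s j) := by
      intro j
      induction j with
      | zero =>
        intro _
        rw [h0]
        exact stateInvariant_init C y d m
      | succ j ih => exact fun hj => (ih (by omega)).step hI (hs j (by omega))
    exact (key N le_rfl).le
  · intro D B f hreach _
    obtain ⟨N, n, hV, -⟩ := exists_stateInvariant hI hreach
    exact algRemTerminates_of_finite (hV.finite_reducers f) f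
  · intro s hreach
    obtain ⟨N, hN⟩ := exists_stateInvariant hI hreach
    cases s with
    | halted out => exact Or.inl ⟨out, .halted out⟩
    | loop D B =>
      obtain ⟨n, hV, -⟩ := hN
      rcases (candidates y m D B).eq_empty_or_nonempty with hemp | hne
      · exact Or.inl ⟨B, .exit D B hemp⟩
      · obtain ⟨f, hf⟩ := hV.exists_isMinRank hne
        obtain ⟨g, hg⟩ := exists_algRem (hV.finite_reducers f) f
        by_cases hrk : rk g = rk f
        · exact Or.inr ⟨_, .update D B f g hf hg hrk⟩
        · exact Or.inr ⟨_, .abort D B f g hf hg hrk⟩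
  · intro s out hreach hret
    obtain ⟨N, hN⟩ := exists_stateInvariant hI hreach
    cases hret with
    | halted out => exact Or.inr hN.2
    | exit D B hemp =>
      left
      obtain ⟨n, hV, -⟩ := hN
      have hn := hV.n_eq_of_candidates_eq_empty hI hemp
      have hex : ∀ i j, ∃ b, j ≤ m i - d i → b ∈ out ∧ ld b = (⟨y i, d i + j⟩ : Deriv Y) := by
        intro i j
        by_cases hj : j ≤ m i - d i
        · obtain ⟨b, hb⟩ := hV.exists_ld i j (by rw [hn i]; omega)
          exact ⟨b, fun _ => hb⟩
        -- The value 0 outside the table is arbitrary.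
        · exact ⟨0, fun h => absurd h hj⟩
      choose b hb using hex
      have hsat := fun i => hV.mem_saturation i (by rw [hn i]; omega)
      refine ⟨b, ?_, ⟨?_, hV.injOn⟩, ?_, ?_, ?_, hV.subset_lowest, hV.diffIdeal_lowest_le, ?_,
        hV.initSep_subset, ?_⟩
      · ext c
        constructor
        · intro hc
          obtain ⟨i, j, hj, hcl, -⟩ := hV.mem_B' hI hc
          have hj' : j ≤ m i - d i := by rw [hn i] at hj; omega
          exact ⟨i, j, hj', hV.injOn hc (hb i j hj').1 (hcl.trans (hb i j hj').2.symm)⟩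
        · rintro ⟨i, j, hj, rfl⟩
          exact (hb i j hj).1
      · intro c hc hbot
        obtain ⟨i, j, hj, hcl, -⟩ := hV.mem_B' hI hc
        rw [hbot] at hcl
        exact WithBot.bot_ne_coe hcl
      · exact fun i j hj => (hV.lt_and_rk hI (hb i j hj).1 (hb i j hj).2).2
      · intro i
        -- This also covers an indeterminate that does not occur, since the empty supremum in `ℕ` is
        -- 0.
        refine csSup_le' ?_
        rintro e ⟨c, hc, he⟩
        exact hV.ord_le_m hI hc he
      · intro v hv
        refine csSup_le' ?_
        rintro e ⟨c, hc, he⟩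
        refine (hV.ord_le c hc v hv e he).trans_eq ?_
        simp [hn]
      · refine diffIdeal_subset_saturation ?_
        rintro _ ⟨i, rfl⟩
        exact (hsat i).1
      · rintro _ (⟨_, ⟨i, rfl⟩, rfl⟩ | ⟨_, ⟨i, rfl⟩, rfl⟩)
        · exact (hsat i).2.1
        · exact (hsat i).2.2
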